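/- For partitions $\lambda,\mu$ of $n$ let $\chi^\lambda(\mu)$ be the value of the irreducible complex character of the symmetric group $S_n$ indexed by $\lambda$ (the character of the Specht module $S^\lambda$) on the permutations of cycle type $\mu$. For a partition $\nu$ with no part equal to $1$ and $n\ge|\nu|$ (where $|\nu|$ is the sum of the parts of $\nu$), write $\nu 1^{n-|\nu|}$ for the partition of $n$ obtained from $\nu$ by adding $n-|\nu|$ parts equal to $1$, and put $$A(\nu)(n)=\sum_{j=0}^{\lfloor n/2\rfloor}\chi^{(n-j,j)}\bigl(\nu 1^{n-|\nu|}\bigr)^2,\qquad B(\nu)(n)=\sum_{j=1}^{n}\chi^{(j,1^{n-j})}\bigl(\nu 1^{n-|\nu|}\bigr)^2,$$ where for $j=0$ the shape $(n-j,j)$ means the one-rowed shape $(n)$ (the empty partition if $n=0$). **Theorem.** Let $s\ge 0$, let $a_1\ge a_2\ge\dots\ge a_s\ge 3$ be odd integers, and let $t\ge 1$. Let $\mu_0$ be the partition with parts $a_1,\dots,a_s,2,2^2,\dots,2^{t-1}$ (if $t=1$, only the odd parts), and let $\mu_0'$ be the partition with parts $a_1,\dots,a_s,2^t$, in each case sorted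 in non-increasing order. Then, for every $n\ge|\mu_0|$, $$A(\mu_0)(n)=\tfrac12\,B(\mu_0')(n+2).$$ -/

import Mathlib

namespace SymChar

open Equiv

/-- The Young diagram of a partition `p` of `n`: row `i` has as many cells as the `i`-th largest
part of `p`. A cell is a pair (row, column). -/
def diagram {n : ℕ} (p : n.Partition) : YoungDiagram :=
  YoungDiagram.ofRowLens (p.parts.sort (· ≥ ·)) (Multiset.pairwise_sort _ _).sortedGE

/-- A (bijective) Young tableau of shape `p`: a filling of the cells of the diagram of `p` with the
numbers `0, …, n - 1`, each used exactly once. -/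
abbrev Tableau {n : ℕ} (p : n.Partition) : Type :=
  (diagram p).cells ≃ Fin n

/-- The representation of the symmetric group on polynomials in `n` variables over `ℂ` by
permutation of the variables: `σ` sends `x_i` to `x_{σ i}`. -/
noncomputable def polyRep (n : ℕ) :
    Representation ℂ (Perm (Fin n)) (MvPolynomial (Fin n) ℂ) where
  toFun σ := (MvPolynomial.rename σ).toLinearMap
  map_one' := by
    refine LinearMap.ext fun f => ?_
    simp
  map_mul' σ τ := by
    refine LinearMap.ext fun f => ?_
    simp [MvPolynomial.rename_rename, Perm.coe_mul]

/-- The Specht polynomial of a tableau `T`: the product of the differences `x_{T c} - x_{T d}` over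
all pairs of cells `c`, `d` in the same column, with `c` above `d`. -/
noncomputable def spechtPolynomial {n : ℕ} {p : n.Partition} (T : Tableau p) :
    MvPolynomial (Fin n) ℂ :=
  ∏ c : (diagram p).cells, ∏ d : (diagram p).cells with c.1.2 = d.1.2 ∧ c.1.1 < d.1.1,
    (MvPolynomial.X (T c) - MvPolynomial.X (T d))

lemma polyRep_spechtPolynomial {n : ℕ} {p : n.Partition} (σ : Perm (Fin n)) (T : Tableau p) :
    polyRep n σ (spechtPolynomial T) = spechtPolynomial (T.trans σ) := by
  simp [polyRep, spechtPolynomial, map_prod]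

/-- The Specht module of shape `p`: the span of the Specht polynomials of all tableaux of shape
`p`, on which the symmetric group acts by permuting the variables. -/
noncomputable def spechtModule {n : ℕ} (p : n.Partition) : Subrepresentation (polyRep n) where
  toSubmodule := Submodule.span ℂ (Set.range fun T : Tableau p => spechtPolynomial T)
  apply_mem_toSubmodule σ v hv := by
    induction hv using Submodule.span_induction with
    | mem x hx =>
      obtain ⟨T, rfl⟩ := hx
      rw [polyRep_spechtPolynomial]
      exact Submodule.subset_span ⟨_, rfl⟩
    | zero => simp
    | add x y _ _ hx hy => rw [map_add]; exact add_mem hx hy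
    | smul c x _ hx => rw [map_smul]; exact Submodule.smul_mem _ c hx

lemma exists_perm_parts {n : ℕ} (q : n.Partition) :
    ∃ σ : Perm (Fin n), σ.partition.parts = q.parts := by
  have hsplit : q.parts.filter (2 ≤ ·) + q.parts.filter (fun x => ¬ 2 ≤ x) = q.parts :=
    Multiset.filter_add_not _ _
  have hones : q.parts.filter (fun x => ¬ 2 ≤ x)
      = Multiset.replicate (q.parts.filter (fun x => ¬ 2 ≤ x)).card 1 := by
    refine Multiset.eq_replicate_card.2 fun b hb => ?_
    obtain ⟨hb1, hb2⟩ := Multiset.mem_filter.1 hb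
    have := q.parts_pos hb1
    omega
  have hsum : (q.parts.filter (2 ≤ ·)).sum
      + (q.parts.filter (fun x => ¬ 2 ≤ x)).card = n := by
    have h := congrArg Multiset.sum hsplit
    rw [Multiset.sum_add, q.parts_sum, hones, Multiset.sum_replicate] at h
    simpa using h
  obtain ⟨σ, hσ⟩ := (Perm.exists_with_cycleType_iff (Fin n)
    (m := q.parts.filter (2 ≤ ·))).2
    ⟨by rw [Fintype.card_fin]; omega, fun a ha => (Multiset.mem_filter.1 ha).2⟩
  refine ⟨σ, ?_⟩
  rw [Perm.parts_partition, ← Perm.sum_cycleType, hσ, Fintype.card_fin]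
  conv_rhs => rw [← hsplit, hones]
  congr 2
  omega

/-- The character value `χ^p(q)` for partitions `p`, `q` of `n`: the trace, on the Specht module of
shape `p`, of a permutation with cycle lengths `q` (fixed points are cycles of length one). -/
noncomputable def chi {n : ℕ} (p q : n.Partition) : ℂ :=
  (spechtModule p).toRepresentation.character (exists_perm_parts q).choose

/-- `chi p q` does not depend on the chosen permutation. -/
lemma chi_eq {n : ℕ} (p q : n.Partition) (σ : Perm (Fin n)) (hσ : σ.partition.parts = q.parts) :
    chi p q = (spechtModule p).toRepresentation.character σ := by
  have h : IsConj σ (exists_perm_parts q).choose :=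
    Perm.partition_eq_of_isConj.2
      (Nat.Partition.ext (hσ.trans (exists_perm_parts q).choose_spec.symm))
  obtain ⟨τ, hτ⟩ := isConj_iff.1 h
  rw [chi, ← hτ, Representation.char_mul_comm, ← mul_assoc, inv_mul_cancel, one_mul]

/-- The partition `m 1^{n-|m|}` of `n`. -/
def padOnes (m : Multiset ℕ) (n : ℕ) (h : m.sum ≤ n) : n.Partition :=
  Nat.Partition.ofSums n (m + Multiset.replicate (n - m.sum) 1) (by simp; omega)

/-- The shape `(n - j, j)` with at most two rows (with one row if `j = 0`), for `j ≤ n / 2`. -/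
def twoRowed (n : ℕ) (j : Fin (n / 2 + 1)) : n.Partition :=
  Nat.Partition.ofSums n {n - (j : ℕ), (j : ℕ)} (by simp; omega)

/-- The hook shape `(j + 1, 1^{n - (j + 1)})`, for `0 ≤ j < n`. -/
def hook (n : ℕ) (j : Fin n) : n.Partition :=
  Nat.Partition.ofSums n (((j : ℕ) + 1) ::ₘ Multiset.replicate (n - ((j : ℕ) + 1)) 1)
    (by simp)

/-- The sum of `χ^p(m 1^{n-|m|})²` over the shapes `p = (n - j, j)`, `0 ≤ j ≤ n / 2`. -/
noncomputable def sumSqTwoRowed (m : Multiset ℕ) (n : ℕ) (h : m.sum ≤ n) : ℂ :=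
  ∑ j : Fin (n / 2 + 1), chi (twoRowed n j) (padOnes m n h) ^ 2

/-- The sum of `χ^p(m 1^{n-|m|})²` over the hook shapes `p = (j, 1^{n-j})`, `1 ≤ j ≤ n`. -/
noncomputable def sumSqHook (m : Multiset ℕ) (n : ℕ) (h : m.sum ≤ n) : ℂ :=
  ∑ j : Fin n, chi (hook n j) (padOnes m n h) ^ 2

/-- The parts `a` together with `2, 4, …, 2^{t-1}`. -/
def withPowers (a : Multiset ℕ) (t : ℕ) : Multiset ℕ :=
  a + (Finset.Ico 1 t).val.map (2 ^ ·)

/-- The parts `a` together with the single part `2^t`. -/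
def withTopPower (a : Multiset ℕ) (t : ℕ) : Multiset ℕ :=
  a + {2 ^ t}

lemma sum_withTopPower {a : Multiset ℕ} {t : ℕ} (ht : 1 ≤ t) :
    (withTopPower a t).sum = (withPowers a t).sum + 2 := by
  have key : ∀ s : ℕ, 2 ^ (s + 1) = (∑ i ∈ Finset.Ico 1 (s + 1), 2 ^ i) + 2 := by
    intro s
    induction s with
    | zero => simp
    | succ k ih => rw [Finset.sum_Ico_succ_top (by omega), pow_succ, ih]; omega
  obtain ⟨s, rfl⟩ := Nat.exists_eq_add_of_le' ht
  have h := key s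
  simp only [withTopPower, withPowers, Multiset.sum_add, Multiset.sum_singleton]
  rw [h, ← add_assoc]
  rfl

lemma sum_withTopPower_le {a : Multiset ℕ} {t n : ℕ} (ht : 1 ≤ t)
    (hn : (withPowers a t).sum ≤ n) : (withTopPower a t).sum ≤ n + 2 := by
  rw [sum_withTopPower ht]
  omega

end SymChar

/-!
Let `μ` be a partition of `n` and `F = (1 - X) ∏ (1 + X ^ r)`, the product running over the parts
`r` of `μ`. The proof rests on two facts about characters:

* `χ^{(n-j,j)}(μ)` is the coefficient of `X ^ j` in `F` (`chi_twoRowed`);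
* if `∏ (1 - (-X) ^ r) = (1 + X) G`, the product running over the parts of a partition `ν` of `N`,
  then `χ^{(N-k,1^k)}(ν)` is the coefficient of `X ^ k` in `G` (`chi_hook`).

For `μ = μ₀ 1^{n-|μ₀|}` and `ν = μ₀' 1^{n-|μ₀|}`, the identity
`(1 + X) (1 - X) (1 + X ^ 2) ⋯ (1 + X ^ (2 ^ (t - 1))) = 1 - X ^ (2 ^ t)` and the oddness of the
other parts give `G = F` (`prod_withTopPower`). So the hook characters of `S_{n+2}` at `ν` are all
the coefficients of `F`, which has degree `n + 1`, and the two-rowed characters of `S_n` at `μ` are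
the first half of them. As `F` is antipalindromic, the squares of the second half repeat those of
the first.

Both character formulas come from short exact sequences of submodules of the polynomial ring, in
which the middle term has a basis indexed by the `j`-subsets of the variables and permuted up to
sign, so that its trace is a sum over invariant subsets, that is, over sets of cycles
(`sum_invariant_subsets_X_pow`).

For two rows the Specht polynomials are the products of `j` differences of distinct variables. They
span the kernel of `D = ∑ ∂ / ∂ x_i` on the squarefree polynomials of degree `j`
(`diffSpan_eq_inf_ker`), and `D` is onto the squarefree polynomials of degree `j - 1`
(`map_sumDeriv_sqfree`). Both rest on the injectivity of the powers of `D` that do not go below the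
complementary degree (`eq_zero_of_sumDeriv_pow_eq_zero`): surjectivity follows by comparing
dimensions, and the kernel is found by induction on the number of variables.

For hooks the Specht polynomials are the Vandermonde determinants in `m = k + 1` variables. The
middle term is the `m`-th exterior power, realised as the span of the determinants with columns
`x, x ^ 2, …, x ^ m`. The linear operator that lowers all positive exponents of a monomial by one
commutes with permutations of the variables and takes these determinants to Vandermonde determinants
in `m` variables. The Vandermonde determinants in `m + 1` variables lie in the exterior power, by
expansion along the constant column, and in the kernel of the operator; a dimension count shows that
they span this kernel (`vdmSpan_eq_inf_ker`).
-/

namespace SymChar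

open Equiv Polynomial

/-! ### Traces on invariant subspaces -/

/-- The trace is additive on a short exact sequence. -/
theorem trace_eq_add_of_exact {K M N P : Type*} [Field K] [AddCommGroup M] [Module K M]
    [AddCommGroup N] [Module K N] [AddCommGroup P] [Module K P] [FiniteDimensional K M]
    [FiniteDimensional K N] [FiniteDimensional K P]
    (i : P →ₗ[K] M) (g : M →ₗ[K] N) (hi : Function.Injective i) (hg : Function.Surjective g)
    (hex : LinearMap.ker g = LinearMap.range i)
    (fP : P →ₗ[K] P) (fM : M →ₗ[K] M) (fN : N →ₗ[K] N)
    (h1 : i ∘ₗ fP = fM ∘ₗ i) (h2 : g ∘ₗ fM = fN ∘ₗ g) :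
    LinearMap.trace K M fM = LinearMap.trace K P fP + LinearMap.trace K N fN := by
  obtain ⟨s, hs⟩ := g.exists_rightInverse_of_surjective (LinearMap.range_eq_top.2 hg)
  have hmem : ∀ x, (LinearMap.id - s ∘ₗ g : M →ₗ[K] M) x ∈ LinearMap.range i := by
    intro x
    rw [← hex, LinearMap.mem_ker]
    have := LinearMap.congr_fun hs (g x)
    simp only [LinearMap.comp_apply, LinearMap.id_apply] at this
    simp [this]
  let r : M →ₗ[K] P := (LinearEquiv.ofInjective i hi).symm.toLinearMap ∘ₗ
    (LinearMap.id - s ∘ₗ g : M →ₗ[K] M).codRestrict (LinearMap.range i) hmem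
  have hir : i ∘ₗ r + s ∘ₗ g = LinearMap.id := by
    ext x
    have : i (r x) = x - s (g x) := by simp [r]
    simp [this]
  have hri : r ∘ₗ i = LinearMap.id := by
    ext x
    apply hi
    have h := LinearMap.congr_fun hir (i x)
    have h0 : g (i x) = 0 := by
      rw [← LinearMap.mem_ker, hex]
      exact ⟨x, rfl⟩
    simpa [h0] using h
  calc LinearMap.trace K M fM
      = LinearMap.trace K M (fM ∘ₗ (i ∘ₗ r + s ∘ₗ g)) := by rw [hir, LinearMap.comp_id]
    _ = LinearMap.trace K M ((i ∘ₗ fP) ∘ₗ r) + LinearMap.trace K M ((fM ∘ₗ s) ∘ₗ g) := by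
        rw [LinearMap.comp_add, map_add, h1]; rfl
    _ = LinearMap.trace K P (r ∘ₗ (i ∘ₗ fP)) + LinearMap.trace K N (g ∘ₗ (fM ∘ₗ s)) := by
        rw [LinearMap.trace_comp_comm', LinearMap.trace_comp_comm' (fM ∘ₗ s)]
    _ = _ := by
        rw [← LinearMap.comp_assoc, hri, ← LinearMap.comp_assoc s fM g, h2,
          LinearMap.comp_assoc, hs]
        rfl

/-- For an operator `f` commuting with `δ`, the trace on an invariant subspace `E` is the sum of
the traces on the kernel and on the image of the restriction of `δ` to `E`. -/
theorem trace_restrict_eq_ker_add_map {K A : Type*} [Field K] [AddCommGroup A] [Module K A]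
    (f δ : A →ₗ[K] A) (hcomm : ∀ x, δ (f x) = f (δ x)) (E V W : Submodule K A)
    [FiniteDimensional K E] (hV : V = E ⊓ LinearMap.ker δ) (hW : W = E.map δ)
    (hfE : ∀ x ∈ E, f x ∈ E) (hfV : ∀ x ∈ V, f x ∈ V) (hfW : ∀ x ∈ W, f x ∈ W) :
    LinearMap.trace K E (f.restrict hfE) =
      LinearMap.trace K V (f.restrict hfV) + LinearMap.trace K W (f.restrict hfW) := by
  have hVE : V ≤ E := hV ▸ inf_le_left
  have hδ : ∀ x ∈ E, δ x ∈ W := fun x hx => hW ▸ Submodule.mem_map_of_mem hx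
  have : FiniteDimensional K V := Submodule.finiteDimensional_of_le hVE
  have : FiniteDimensional K W := hW ▸ inferInstance
  refine trace_eq_add_of_exact (Submodule.inclusion hVE) (δ.restrict hδ)
    (Submodule.inclusion_injective hVE) ?_ ?_ _ _ _ ?_ ?_
  · rintro ⟨y, hy⟩
    rw [hW] at hy
    obtain ⟨x, hx, rfl⟩ := hy
    exact ⟨⟨x, hx⟩, rfl⟩
  · ext ⟨x, hx⟩
    simp only [LinearMap.mem_ker, LinearMap.mem_range]
    constructor
    · intro h
      have h' : δ x = 0 := congrArg Subtype.val h
      exact ⟨⟨x, by rw [hV]; exact ⟨hx, h'⟩⟩, rfl⟩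
    · rintro ⟨⟨y, hy⟩, hyx⟩
      obtain rfl : y = x := congrArg Subtype.val hyx
      rw [hV] at hy
      exact Subtype.ext hy.2
  · ext x; rfl
  · ext x; exact hcomm _

/-- The trace of an operator that permutes a basis up to scalars. -/
theorem trace_restrict_span_range {K A ι : Type*} [Field K] [AddCommGroup A] [Module K A]
    [Fintype ι] [DecidableEq ι] (b : ι → A) (hb : LinearIndependent K b) (f : A →ₗ[K] A)
    (π : ι → ι) (ε : ι → K) (hf : ∀ i, f (b i) = ε i • b (π i))
    (h : ∀ x ∈ Submodule.span K (Set.range b), f x ∈ Submodule.span K (Set.range b)) :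
    LinearMap.trace K _ (f.restrict h) = ∑ i with π i = i, ε i := by
  rw [LinearMap.trace_eq_matrix_trace K (Module.Basis.span hb), Matrix.trace, Finset.sum_filter]
  refine Finset.sum_congr rfl fun i _ => ?_
  have : f.restrict h (Module.Basis.span hb i) = ε i • Module.Basis.span hb (π i) := by
    apply Subtype.ext
    simp [Module.Basis.span_apply, hf]
  rw [Matrix.diag_apply, LinearMap.toMatrix_apply, this, map_smul, Module.Basis.repr_self]
  simp [Finsupp.single_apply]

/-- A family is linearly independent if every member is detected by a linear map killing all the
others. -/
theorem linearIndependent_of_detecting {K A B ι : Type*} [Field K] [AddCommGroup A] [Module K A]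
    [AddCommGroup B] [Module K B] (b : ι → A) (e : ι → A →ₗ[K] B) (h1 : ∀ i, e i (b i) ≠ 0)
    (h2 : ∀ i j, i ≠ j → e i (b j) = 0) : LinearIndependent K b := by
  classical
  rw [linearIndependent_iff']
  intro s g hg i hi
  have := congrArg (e i) hg
  rw [map_sum, map_zero, Finset.sum_eq_single i] at this
  · rw [map_smul] at this
    exact (smul_eq_zero.1 this).resolve_right (h1 i)
  · intro j _ hj
    rw [map_smul, h2 i j hj.symm, smul_zero]
  · exact fun h => (h hi).elim

/-! ### Subsets invariant under a permutation -/

section InvariantSubsets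

variable {α : Type*} [Fintype α] [DecidableEq α]

omit [Fintype α] [DecidableEq α] in
lemma map_perm_eq_self_iff (σ : Perm α) (S : Finset α) :
    S.map σ.toEmbedding = S ↔ ∀ x, x ∈ S ↔ σ x ∈ S := by
  constructor
  · intro h x
    conv_rhs => rw [← h]
    simp
  · intro h
    refine Finset.eq_of_subset_of_card_le ?_ (Finset.card_map _).ge
    intro y hy
    obtain ⟨x, hx, rfl⟩ := Finset.mem_map.1 hy
    exact (h x).1 hx

lemma support_subset_of_mem_invariant {σ : Perm α} {S : Finset α}
    (hS : ∀ x, x ∈ S ↔ σ x ∈ S) {x : α} (hx : x ∈ S) : (σ.cycleOf x).support ⊆ S := by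
  intro y hy
  obtain ⟨k, -, rfl⟩ := (Perm.mem_support_cycleOf_iff.1 hy).1.exists_pow_eq'
  clear hy
  induction k with
  | zero => exact hx
  | succ k ih => rw [pow_succ', Perm.mul_apply]; exact (hS _).1 ih

/-- The invariant subsets of a permutation are the unions of a set of its cycles and a set of its
fixed points, so a sum over them of multiplicative weights is a product. -/
theorem sum_invariant_subsets {R : Type*} [CommSemiring R] (σ : Perm α) (φ : Perm α → R) (q : R) :
    ∑ S : Finset α with S.map σ.toEmbedding = S,
      (∏ c ∈ σ.cycleFactorsFinset with c.support ⊆ S, φ c) *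
        q ^ (S.filter fun x => σ x = x).card =
    (∏ c ∈ σ.cycleFactorsFinset, (1 + φ c)) *
      (1 + q) ^ (Finset.univ.filter fun x => σ x = x).card := by
  have h2 : (1 + q) ^ (Finset.univ.filter fun x => σ x = x).card =
      ∑ r ∈ (Finset.univ.filter fun x => σ x = x).powerset, q ^ r.card := by
    rw [← Finset.prod_const, Finset.prod_one_add]
    simp
  rw [h2, Finset.prod_one_add, Finset.sum_mul_sum, ← Finset.sum_product']
  have hdis : ∀ c ∈ σ.cycleFactorsFinset, ∀ x ∈ c.support, σ x ≠ x := fun c hc x hx =>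
    Perm.mem_support.1 (Perm.mem_cycleFactorsFinset_support_le hc hx)
  refine Finset.sum_bij' (fun S _ => (σ.cycleFactorsFinset.filter (fun c => c.support ⊆ S),
      S.filter fun x => σ x = x)) (fun p _ => p.1.biUnion Perm.support ∪ p.2)
    ?_ ?_ ?_ ?_ (fun S _ => rfl)
  · intro S _
    simp [Finset.filter_subset, Finset.filter_subset_filter]
  · rintro ⟨t, r⟩ hp
    simp only [Finset.mem_product, Finset.mem_powerset] at hp
    simp only [Finset.mem_filter, Finset.mem_univ, true_and, map_perm_eq_self_iff]
    intro x
    have hcyc : ∀ c ∈ t, (x ∈ c.support ↔ σ x ∈ c.support) := fun c hc =>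
      (Perm.mem_cycleFactorsFinset_support (hp.1 hc) x).symm
    have hfix : x ∈ r ↔ σ x ∈ r := by
      constructor
      · intro h
        rwa [(Finset.mem_filter.1 (hp.2 h)).2]
      · intro h
        have := (Finset.mem_filter.1 (hp.2 h)).2
        rwa [σ.injective this] at h
    simp only [Finset.mem_union, Finset.mem_biUnion]
    rw [hfix]
    exact or_congr_left (exists_congr fun c => and_congr_right fun hc => hcyc c hc)
  · intro S hS
    simp only [Finset.mem_filter, Finset.mem_univ, true_and, map_perm_eq_self_iff] at hS
    ext x
    simp only [Finset.mem_union, Finset.mem_biUnion, Finset.mem_filter]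
    constructor
    · rintro (⟨c, ⟨_, hc⟩, hx⟩ | h)
      · exact hc hx
      · exact h.1
    · intro hx
      by_cases hfix : σ x = x
      · exact Or.inr ⟨hx, hfix⟩
      · refine Or.inl ⟨σ.cycleOf x, ⟨Perm.cycleOf_mem_cycleFactorsFinset_iff.2
          (Perm.mem_support.2 hfix), support_subset_of_mem_invariant hS hx⟩, ?_⟩
        exact Perm.mem_support_cycleOf_iff.2 ⟨Perm.SameCycle.refl _ _, Perm.mem_support.2 hfix⟩
  · rintro ⟨t, r⟩ hp
    simp only [Finset.mem_product, Finset.mem_powerset] at hp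
    obtain ⟨ht, hr⟩ := hp
    refine Prod.ext ?_ ?_
    · ext c
      simp only [Finset.mem_filter]
      constructor
      · rintro ⟨hc, hsub⟩
        obtain ⟨x, hx⟩ := (Perm.mem_cycleFactorsFinset_iff.1 hc).1.nonempty_support
        rcases Finset.mem_union.1 (hsub hx) with h | h
        · obtain ⟨c', hc', hx'⟩ := Finset.mem_biUnion.1 h
          rw [Perm.cycle_is_cycleOf hx hc, ← Perm.cycle_is_cycleOf hx' (ht hc')]
          exact hc'
        · exact absurd (Finset.mem_filter.1 (hr h)).2 (hdis c hc x hx)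
      · intro hc
        exact ⟨ht hc, fun x hx => Finset.mem_union_left _ (Finset.mem_biUnion.2 ⟨c, hc, hx⟩)⟩
    · ext x
      simp only [Finset.mem_filter, Finset.mem_union, Finset.mem_biUnion]
      constructor
      · rintro ⟨⟨c, hc, hx⟩ | h, hfix⟩
        · exact absurd hfix (hdis c (ht hc) x hx)
        · exact h
      · exact fun h => ⟨Or.inr h, (Finset.mem_filter.1 (hr h)).2⟩

lemma card_eq_sum_of_invariant {σ : Perm α} {S : Finset α} (hS : ∀ x, x ∈ S ↔ σ x ∈ S) :
    S.card = ∑ c ∈ σ.cycleFactorsFinset with c.support ⊆ S, c.support.card +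
      (S.filter fun x => σ x = x).card := by
  rw [← Finset.card_filter_add_card_filter_not (s := S) (fun x => σ x = x), add_comm]
  congr 1
  rw [← Finset.card_biUnion]
  · congr 1
    ext x
    simp only [Finset.mem_filter, Finset.mem_biUnion]
    constructor
    · rintro ⟨hx, hfix⟩
      exact ⟨σ.cycleOf x, ⟨Perm.cycleOf_mem_cycleFactorsFinset_iff.2
        (Perm.mem_support.2 hfix), support_subset_of_mem_invariant hS hx⟩,
        Perm.mem_support_cycleOf_iff.2 ⟨Perm.SameCycle.refl _ _, Perm.mem_support.2 hfix⟩⟩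
    · rintro ⟨c, ⟨hc, hsub⟩, hx⟩
      exact ⟨hsub hx, Perm.mem_support.1 (Perm.mem_cycleFactorsFinset_support_le hc hx)⟩
  · intro c hc c' hc' hne
    exact (σ.cycleFactorsFinset_pairwise_disjoint (Finset.mem_filter.1 hc).1
      (Finset.mem_filter.1 hc').1 hne).disjoint_support

/-- Generating function, by cardinality, of the invariant subsets of a permutation, each weighted
by the product of `u r` over its cycles, `r` being the length of the cycle. -/
theorem sum_invariant_subsets_X_pow {K : Type*} [CommSemiring K] (σ : Perm α) (u : ℕ → K)
    (hu : u 1 = 1) :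
    ∑ S : Finset α with S.map σ.toEmbedding = S,
      C (∏ c ∈ σ.cycleFactorsFinset with c.support ⊆ S, u c.support.card) * X ^ S.card =
    (σ.partition.parts.map fun r => 1 + C (u r) * X ^ r : Multiset K[X]).prod := by
  have h := sum_invariant_subsets σ (fun c => C (u c.support.card) * X ^ c.support.card) (X : K[X])
  have hfix : (Finset.univ.filter fun x => σ x = x).card = Fintype.card α - σ.support.card := by
    rw [← Finset.card_compl]
    congr 1
    ext x
    simp
  rw [Perm.parts_partition, Multiset.map_add, Multiset.prod_add, Multiset.map_replicate,
    Multiset.prod_replicate, hu, map_one, one_mul, pow_one, ← hfix, Perm.cycleType_def,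
    Multiset.map_map]
  refine Eq.trans (Finset.sum_congr rfl fun S hS => ?_) h
  have hS' := (map_perm_eq_self_iff σ S).1 (Finset.mem_filter.1 hS).2
  rw [Finset.prod_mul_distrib, Finset.prod_pow_eq_pow_sum, mul_assoc, ← pow_add,
    ← card_eq_sum_of_invariant hS', map_prod]

theorem sum_invariant_subsets_card_eq {K : Type*} [CommSemiring K] (σ : Perm α) (u : ℕ → K)
    (hu : u 1 = 1) (m : ℕ) :
    ∑ S : {S : Finset α // S.card = m} with S.1.map σ.toEmbedding = S.1,
      ∏ c ∈ σ.cycleFactorsFinset with c.support ⊆ S.1, u c.support.card =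
    (σ.partition.parts.map fun r => 1 + C (u r) * X ^ r : Multiset K[X]).prod.coeff m := by
  rw [← sum_invariant_subsets_X_pow σ u hu, finsetSum_coeff, Finset.sum_filter, Finset.sum_filter]
  rw [← Finset.sum_subtype (Finset.univ.filter fun S : Finset α => S.card = m) (by simp)
    (fun S => if S.map σ.toEmbedding = S then
      ∏ c ∈ σ.cycleFactorsFinset with c.support ⊆ S, u c.support.card else 0), Finset.sum_filter]
  refine Finset.sum_congr rfl fun S _ => ?_
  simp only [coeff_C_mul_X_pow, eq_comm (a := m)]
  split_ifs <;> rfl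

/-- The sign of the restriction of a permutation to an invariant subset. -/
theorem sign_subtypePerm_eq_prod (σ : Perm α) (S : Finset α) (hS : ∀ x, σ x ∈ S ↔ x ∈ S) :
    Perm.sign (σ.subtypePerm hS) =
      ∏ c ∈ σ.cycleFactorsFinset with c.support ⊆ S, (-1 : ℤˣ) ^ (c.support.card + 1) := by
  have hval : ∀ x, Perm.ofSubtype (σ.subtypePerm hS) x = if x ∈ S then σ x else x := by
    intro x
    split_ifs with h
    · rw [Perm.ofSubtype_apply_of_mem _ h]; rfl
    · exact Perm.ofSubtype_apply_of_not_mem _ h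
  have hfac : (Perm.ofSubtype (σ.subtypePerm hS)).cycleFactorsFinset =
      σ.cycleFactorsFinset.filter fun c => c.support ⊆ S := by
    ext c
    rw [Finset.mem_filter, Perm.mem_cycleFactorsFinset_iff, Perm.mem_cycleFactorsFinset_iff,
      and_assoc]
    refine and_congr_right fun _ => ?_
    constructor
    · intro h
      have hS : c.support ⊆ S := by
        intro x hx
        by_contra hxS
        have := h x hx
        rw [hval, if_neg hxS] at this
        exact Perm.mem_support.1 hx this
      refine ⟨fun x hx => ?_, hS⟩
      rw [h x hx, hval, if_pos (hS hx)]
    · rintro ⟨h, hS⟩ x hx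
      rw [h x hx, hval, if_pos (hS hx)]
  rw [← Perm.sign_ofSubtype, Perm.sign_of_cycleType', Perm.cycleType_def, Multiset.map_map, hfac]
  refine Finset.prod_congr rfl fun c _ => ?_
  simp [pow_succ]

end InvariantSubsets

end SymChar

namespace SymChar

open Equiv MvPolynomial

/-! ### Squarefree polynomials -/

section Squarefree

variable {τ : Type*}

/-- The squarefree monomial with support `S`. -/
noncomputable def mon (S : Finset τ) : MvPolynomial τ ℂ := ∏ i ∈ S, X i

/-- The homogeneous squarefree polynomials of degree `j` in the variables indexed by `s`. -/
noncomputable def sqfree (j : ℕ) (s : Finset τ) : Submodule ℂ (MvPolynomial τ ℂ) :=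
  Submodule.span ℂ (Set.range fun S : {S : Finset τ // S ∈ s.powersetCard j} => mon S.1)

/-- The derivation `∑ i, ∂ / ∂ x_i`. -/
noncomputable def sumDeriv : Derivation ℂ (MvPolynomial τ ℂ) (MvPolynomial τ ℂ) :=
  mkDerivation ℂ fun _ => 1

/-- The substitution of `0` for the variables outside `S`. -/
noncomputable def keepVars [DecidableEq τ] (S : Finset τ) :
    MvPolynomial τ ℂ →ₐ[ℂ] MvPolynomial τ ℂ :=
  aeval fun i => if i ∈ S then X i else 0

@[simp] lemma sumDeriv_X (i : τ) : sumDeriv (X i : MvPolynomial τ ℂ) = 1 :=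
  mkDerivation_X _ _ _

lemma mon_mem_sqfree {S s : Finset τ} {j : ℕ} (hS : S ⊆ s) (hj : S.card = j) :
    mon S ∈ sqfree j s :=
  Submodule.subset_span ⟨⟨S, Finset.mem_powersetCard.2 ⟨hS, hj⟩⟩, rfl⟩

lemma sqfree_induction {j : ℕ} {s : Finset τ} {p : MvPolynomial τ ℂ → Prop}
    (hmon : ∀ S ⊆ s, S.card = j → p (mon S)) (hzero : p 0)
    (hadd : ∀ f g, p f → p g → p (f + g)) (hsmul : ∀ (c : ℂ) f, p f → p (c • f))
    {f : MvPolynomial τ ℂ} (hf : f ∈ sqfree j s) : p f := by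
  refine Submodule.span_induction (p := fun f _ => p f) ?_ hzero (fun f g _ _ => hadd f g)
    (fun c f _ => hsmul c f) hf
  rintro _ ⟨S, rfl⟩
  exact hmon _ (Finset.mem_powersetCard.1 S.2).1 (Finset.mem_powersetCard.1 S.2).2

lemma sqfree_mono {j : ℕ} {s t : Finset τ} (h : s ⊆ t) : sqfree j s ≤ sqfree j t := fun _ hf =>
  sqfree_induction (p := (· ∈ sqfree j t)) (fun _ hS hj => mon_mem_sqfree (hS.trans h) hj)
    (zero_mem _) (fun _ _ => add_mem) (fun c _ => Submodule.smul_mem _ c) hf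

lemma X_mul_mem_sqfree [DecidableEq τ] {j : ℕ} {s : Finset τ} {a : τ} (ha : a ∉ s)
    {f : MvPolynomial τ ℂ} (hf : f ∈ sqfree j s) : X a * f ∈ sqfree (j + 1) (insert a s) := by
  refine sqfree_induction (p := fun f => X a * f ∈ sqfree (j + 1) (insert a s)) ?_ ?_ ?_ ?_ hf
  · intro S hS hj
    have haS : a ∉ S := fun h => ha (hS h)
    rw [show X a * mon S = mon (insert a S) from (Finset.prod_insert haS).symm]
    exact mon_mem_sqfree (Finset.insert_subset_insert a hS)
      (by rw [Finset.card_insert_of_notMem haS, hj])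
  · simp
  · intro f g hf hg
    rw [mul_add]
    exact add_mem hf hg
  · intro c f hf
    rw [mul_smul_comm]
    exact Submodule.smul_mem _ c hf

lemma exists_eq_add_X_mul [DecidableEq τ] {j : ℕ} {s : Finset τ} {a : τ}
    {f : MvPolynomial τ ℂ} (hf : f ∈ sqfree (j + 1) (insert a s)) :
    ∃ g ∈ sqfree (j + 1) s, ∃ h ∈ sqfree j s, f = g + X a * h := by
  refine sqfree_induction
    (p := fun f => ∃ g ∈ sqfree (j + 1) s, ∃ h ∈ sqfree j s, f = g + X a * h) ?_ ?_ ?_ ?_ hf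
  · intro S hS hj
    by_cases haS : a ∈ S
    · refine ⟨0, zero_mem _, mon (S.erase a), mon_mem_sqfree ?_ ?_, ?_⟩
      · exact (Finset.erase_subset_erase a hS).trans (Finset.erase_insert_subset a s)
      · rw [Finset.card_erase_of_mem haS, hj]; rfl
      · rw [zero_add, mon, mon, Finset.mul_prod_erase S _ haS]
    · exact ⟨mon S, mon_mem_sqfree ((Finset.subset_insert_iff_of_notMem haS).1 hS) hj, 0,
        zero_mem _, by simp⟩
  · exact ⟨0, zero_mem _, 0, zero_mem _, by simp⟩
  · rintro _ _ ⟨g, hg, h, hh, rfl⟩ ⟨g', hg', h', hh', rfl⟩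
    exact ⟨g + g', add_mem hg hg', h + h', add_mem hh hh', by ring⟩
  · rintro c _ ⟨g, hg, h, hh, rfl⟩
    exact ⟨c • g, Submodule.smul_mem _ c hg, c • h, Submodule.smul_mem _ c hh, by
      rw [smul_add, mul_smul_comm]⟩

lemma mem_sqfree_zero {s : Finset τ} {f : MvPolynomial τ ℂ} (hf : f ∈ sqfree 0 s) :
    ∃ c : ℂ, f = c • 1 := by
  refine sqfree_induction (p := fun f => ∃ c : ℂ, f = c • 1) ?_ ⟨0, by simp⟩ ?_ ?_ hf
  · intro S _ hS
    rw [Finset.card_eq_zero.1 hS]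
    exact ⟨1, by simp [mon]⟩
  · rintro _ _ ⟨c, rfl⟩ ⟨c', rfl⟩
    exact ⟨c + c', (add_smul _ _ _).symm⟩
  · rintro c _ ⟨c', rfl⟩
    exact ⟨c * c', smul_smul _ _ _⟩

lemma sumDeriv_eq_zero_of_mem_sqfree_zero {s : Finset τ} {f : MvPolynomial τ ℂ}
    (hf : f ∈ sqfree 0 s) : sumDeriv f = 0 := by
  obtain ⟨c, rfl⟩ := mem_sqfree_zero hf
  simp

lemma sumDeriv_mem_sqfree [DecidableEq τ] {s : Finset τ} : ∀ {j : ℕ} {f : MvPolynomial τ ℂ},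
    f ∈ sqfree (j + 1) s → sumDeriv f ∈ sqfree j s := by
  induction s using Finset.induction_on with
  | empty =>
    intro j f hf
    have h0 : f = 0 := by
      refine sqfree_induction (p := fun f => f = 0) ?_ rfl ?_ ?_ hf
      · intro S hS hj
        simp [Finset.subset_empty.1 hS] at hj
      · rintro _ _ rfl rfl; simp
      · rintro c _ rfl; simp
    rw [h0, map_zero]
    exact zero_mem _
  | insert a s ha ih =>
    intro j f hf
    obtain ⟨g, hg, h, hh, rfl⟩ := exists_eq_add_X_mul hf
    rw [map_add, Derivation.leibniz, sumDeriv_X, smul_eq_mul, smul_eq_mul, mul_one]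
    refine add_mem (sqfree_mono (Finset.subset_insert a s) (ih hg))
      (add_mem ?_ (sqfree_mono (Finset.subset_insert a s) hh))
    cases j with
    | zero => rw [sumDeriv_eq_zero_of_mem_sqfree_zero hh, mul_zero]; exact zero_mem _
    | succ j => exact X_mul_mem_sqfree ha (ih hh)

lemma sumDeriv_pow_mem_sqfree [DecidableEq τ] {s : Finset τ} {i : ℕ} (k : ℕ)
    {f : MvPolynomial τ ℂ} (hf : f ∈ sqfree (i + k) s) :
    ((sumDeriv (τ := τ)).toLinearMap ^ k) f ∈ sqfree i s := by
  induction k generalizing i f with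
  | zero => exact hf
  | succ k ih =>
    rw [pow_succ', Module.End.mul_apply]
    exact sumDeriv_mem_sqfree (ih (by rwa [add_assoc, add_comm 1 k]))

lemma mon_mem_supported {S s : Finset τ} (h : S ⊆ s) : mon S ∈ supported ℂ (s : Set τ) :=
  Subalgebra.prod_mem _ fun _ hi => X_mem_supported.2 (h hi)

lemma sqfree_le_supported {j : ℕ} {s : Finset τ} {f : MvPolynomial τ ℂ} (hf : f ∈ sqfree j s) :
    f ∈ supported ℂ (s : Set τ) :=
  sqfree_induction (p := (· ∈ supported ℂ (s : Set τ))) (fun _ hS _ => mon_mem_supported hS)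
    (zero_mem _) (fun _ _ => add_mem) (fun c _ hf => Subalgebra.smul_mem _ hf c) hf

lemma sumDeriv_mem_supported {s : Set τ} {f : MvPolynomial τ ℂ} (hf : f ∈ supported ℂ s) :
    sumDeriv f ∈ supported ℂ s := by
  induction hf using Algebra.adjoin_induction with
  | mem x hx =>
    obtain ⟨i, _, rfl⟩ := hx
    rw [sumDeriv_X]
    exact one_mem _
  | algebraMap r => rw [Derivation.map_algebraMap]; exact zero_mem _
  | add x y _ _ hx hy => rw [map_add]; exact add_mem hx hy
  | mul x y hx' hy' hx hy =>
    rw [Derivation.leibniz]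
    exact add_mem (mul_mem hx' hy) (mul_mem hy' hx)

lemma sumDeriv_pow_mem_supported {s : Set τ} (k : ℕ) {f : MvPolynomial τ ℂ}
    (hf : f ∈ supported ℂ s) : ((sumDeriv (τ := τ)).toLinearMap ^ k) f ∈ supported ℂ s := by
  induction k with
  | zero => exact hf
  | succ k ih => rw [pow_succ', Module.End.mul_apply]; exact sumDeriv_mem_supported ih

lemma keepVars_of_mem_supported [DecidableEq τ] {s : Finset τ} {f : MvPolynomial τ ℂ}
    (hf : f ∈ supported ℂ (s : Set τ)) : keepVars s f = f := by
  induction hf using Algebra.adjoin_induction with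
  | mem x hx =>
    obtain ⟨i, hi, rfl⟩ := hx
    simp only [keepVars, aeval_X]
    exact if_pos hi
  | algebraMap r => exact AlgHom.commutes _ r
  | add x y _ _ hx hy => rw [map_add, hx, hy]
  | mul x y _ _ hx hy => rw [map_mul, hx, hy]

lemma keepVars_mon_eq_zero [DecidableEq τ] {s S : Finset τ} (h : ¬ S ⊆ s) :
    keepVars s (mon S) = 0 := by
  obtain ⟨i, hi, his⟩ := Finset.not_subset.1 h
  rw [mon, map_prod]
  exact Finset.prod_eq_zero hi (by simp [keepVars, his])

lemma mon_ne_zero (S : Finset τ) : mon S ≠ 0 :=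
  Finset.prod_ne_zero_iff.2 fun i _ => X_ne_zero i

/-- Multiples of distinct squarefree monomials of the same degree, by nonzero polynomials in the
variables of the monomial, are linearly independent. -/
lemma linearIndependent_mon_mul [DecidableEq τ] {ι : Type*} {m : ℕ} (S : ι → Finset τ)
    (hS : Function.Injective S) (hm : ∀ i, (S i).card = m) (c : ι → MvPolynomial τ ℂ)
    (hc : ∀ i, c i ∈ supported ℂ (S i : Set τ)) (hc0 : ∀ i, c i ≠ 0) :
    LinearIndependent ℂ fun i => mon (S i) * c i := by
  refine linearIndependent_of_detecting _ (fun i => (keepVars (S i)).toLinearMap) ?_ ?_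
  · intro i
    rw [AlgHom.toLinearMap_apply, keepVars_of_mem_supported
      (mul_mem (mon_mem_supported (Finset.Subset.refl _)) (hc i))]
    exact mul_ne_zero (mon_ne_zero _) (hc0 i)
  · intro i j hij
    have : ¬ S j ⊆ S i := fun h =>
      hij (hS (Finset.eq_of_subset_of_card_le h (by rw [hm, hm])).symm)
    rw [AlgHom.toLinearMap_apply, map_mul, keepVars_mon_eq_zero this, zero_mul]

lemma linearIndependent_mon [DecidableEq τ] {ι : Type*} {m : ℕ} (S : ι → Finset τ)
    (hS : Function.Injective S) (hm : ∀ i, (S i).card = m) :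
    LinearIndependent ℂ fun i => mon (S i) := by
  simpa using linearIndependent_mon_mul S hS hm (fun _ => 1) (fun _ => one_mem _)
    (fun _ => one_ne_zero)

instance (j : ℕ) (s : Finset τ) : FiniteDimensional ℂ (sqfree j s) :=
  FiniteDimensional.span_of_finite ℂ (Set.finite_range _)

lemma finrank_sqfree [DecidableEq τ] (j : ℕ) (s : Finset τ) :
    Module.finrank ℂ (sqfree j s) = s.card.choose j := by
  rw [sqfree, finrank_span_eq_card, Fintype.card_coe, Finset.card_powersetCard]
  exact linearIndependent_mon (fun S : {S : Finset τ // S ∈ s.powersetCard j} => S.1)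
    Subtype.val_injective (fun S => (Finset.mem_powersetCard.1 S.2).2)

lemma eq_zero_of_add_X_mul_eq_zero [DecidableEq τ] {s : Finset τ} {a : τ} (ha : a ∉ s)
    {g h : MvPolynomial τ ℂ} (hg : g ∈ supported ℂ (s : Set τ)) (hgh : g + X a * h = 0) :
    g = 0 ∧ h = 0 := by
  have h1 := congrArg (keepVars s) hgh
  rw [map_add, map_mul, keepVars_of_mem_supported hg, map_zero] at h1
  have h2 : keepVars s (X a : MvPolynomial τ ℂ) = 0 := by simp [keepVars, ha]
  rw [h2, zero_mul, add_zero] at h1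
  refine ⟨h1, ?_⟩
  rw [h1, zero_add] at hgh
  exact (mul_eq_zero.1 hgh).resolve_left (X_ne_zero a)

/-- Leibniz rule for the powers of `∑ i, ∂ / ∂ x_i` on a product with a variable. The summand
without the factor `x_a` is the part free of `x_a` when `g` and `h` do not involve `x_a`. -/
lemma sumDeriv_pow_add_X_mul (a : τ) (g h : MvPolynomial τ ℂ) (k : ℕ) :
    ((sumDeriv (τ := τ)).toLinearMap ^ (k + 1)) (g + X a * h) =
      (((sumDeriv (τ := τ)).toLinearMap ^ (k + 1)) g +
        ((k + 1 : ℕ) : ℂ) • ((sumDeriv (τ := τ)).toLinearMap ^ k) h) +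
        X a * ((sumDeriv (τ := τ)).toLinearMap ^ (k + 1)) h := by
  induction k with
  | zero => simp [Derivation.leibniz]; ring
  | succ k ih =>
    have hp : ∀ (m : ℕ) (f : MvPolynomial τ ℂ), ((sumDeriv (τ := τ)).toLinearMap ^ (m + 1)) f =
        sumDeriv (((sumDeriv (τ := τ)).toLinearMap ^ m) f) := fun m f => by
      rw [pow_succ', Module.End.mul_apply]; rfl
    rw [hp (k + 1) (g + _), ih]
    simp only [map_add, Derivation.map_smul, Derivation.leibniz, sumDeriv_X, smul_eq_mul, mul_one,
      ← hp]
    push_cast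
    module

/-- Powers of `∑ i, ∂ / ∂ x_i` are injective on squarefree polynomials as long as they do not go
down further than to the complementary degree. -/
theorem eq_zero_of_sumDeriv_pow_eq_zero [DecidableEq τ] {s : Finset τ} : ∀ {j k : ℕ}
    {f : MvPolynomial τ ℂ}, f ∈ sqfree j s → k + s.card ≤ 2 * j →
    ((sumDeriv (τ := τ)).toLinearMap ^ k) f = 0 → f = 0 := by
  induction s using Finset.induction_on with
  | empty =>
    intro j k f hf hk h
    cases j with
    | zero =>
      obtain rfl : k = 0 := by simpa using hk
      exact h
    | succ j =>
      have : f ∈ (⊥ : Submodule ℂ (MvPolynomial τ ℂ)) := by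
        have h0 : sqfree (j + 1) (∅ : Finset τ) = ⊥ := by
          rw [← Submodule.finrank_eq_zero (R := ℂ), finrank_sqfree]; rfl
        rwa [← h0]
      simpa using this
  | insert a s ha ih =>
    intro j k f hf hk h
    rw [Finset.card_insert_of_notMem ha] at hk
    cases k with
    | zero => exact h
    | succ k =>
      obtain ⟨j, rfl⟩ := Nat.exists_eq_add_of_le' (show 1 ≤ j by omega)
      obtain ⟨g, hg, h', hh', rfl⟩ := exists_eq_add_X_mul hf
      rw [sumDeriv_pow_add_X_mul] at h
      have hgs := sqfree_le_supported hg
      have hhs := sqfree_le_supported hh'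
      obtain ⟨h1, h3⟩ := eq_zero_of_add_X_mul_eq_zero ha (add_mem (sumDeriv_pow_mem_supported _ hgs)
        (Subalgebra.smul_mem _ (sumDeriv_pow_mem_supported _ hhs) _)) h
      have hg0 : g = 0 := by
        refine ih hg (k := k + 2) (by omega) ?_
        have := congrArg (sumDeriv (τ := τ)).toLinearMap h1
        rw [map_add, map_smul, map_zero, ← Module.End.mul_apply, ← pow_succ',
          ← Module.End.mul_apply, ← pow_succ', h3, smul_zero, add_zero] at this
        exact this
      have hh0 : h' = 0 := by
        refine ih hh' (k := k) (by omega) ?_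
        rw [hg0, map_zero, zero_add] at h1
        exact (smul_eq_zero.1 h1).resolve_left (by exact_mod_cast Nat.succ_ne_zero k)
      rw [hg0, hh0, mul_zero, add_zero]

/-- Below the middle degree, `∑ i, ∂ / ∂ x_i` is onto. The power of the operator that joins
complementary degrees is injective between spaces of the same dimension. -/
theorem map_sumDeriv_sqfree [DecidableEq τ] {s : Finset τ} {i : ℕ} (h : 2 * i + 1 ≤ s.card) :
    (sqfree (i + 1) s).map (sumDeriv (τ := τ)).toLinearMap = sqfree i s := by
  refine le_antisymm ?_ ?_
  · rintro _ ⟨f, hf, rfl⟩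
    exact sumDeriv_mem_sqfree hf
  · intro g hg
    obtain ⟨k, hk⟩ := Nat.exists_eq_add_of_le h
    let L := ((sumDeriv (τ := τ)).toLinearMap ^ (k + 1)).restrict
      (p := sqfree (i + (k + 1)) s) (q := sqfree i s) fun f hf => sumDeriv_pow_mem_sqfree _ hf
    have hinj : Function.Injective L := by
      rw [injective_iff_map_eq_zero]
      rintro ⟨f, hf⟩ hL
      exact Subtype.ext (eq_zero_of_sumDeriv_pow_eq_zero hf (k := k + 1) (by omega)
        (congrArg Subtype.val hL))
    have hsurj : Function.Surjective L :=
      (LinearMap.injective_iff_surjective_of_finrank_eq_finrank (by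
        rw [finrank_sqfree, finrank_sqfree]
        exact Nat.choose_symm_of_eq_add (by omega))).1 hinj
    obtain ⟨⟨f, hf⟩, hfg⟩ := hsurj ⟨g, hg⟩
    refine ⟨((sumDeriv (τ := τ)).toLinearMap ^ k) f,
      sumDeriv_pow_mem_sqfree k (by rwa [add_assoc, add_comm 1 k]), ?_⟩
    have := congrArg Subtype.val hfg
    rwa [← Module.End.mul_apply, ← pow_succ']

end Squarefree

end SymChar

namespace SymChar

open Equiv MvPolynomial

/-! ### Products of disjoint differences -/

section Differences

variable {τ : Type*}

/-- The product of the differences `x_{a l} - x_{b l}`. -/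
noncomputable def diffProd {j : ℕ} (a b : Fin j → τ) : MvPolynomial τ ℂ :=
  ∏ l, (X (a l) - X (b l))

/-- The span of the products of `j` differences of variables, all distinct and indexed by elements
of `s`. -/
noncomputable def diffSpan (j : ℕ) (s : Set τ) : Submodule ℂ (MvPolynomial τ ℂ) :=
  Submodule.span ℂ {f | ∃ a b : Fin j → τ, Function.Injective (Sum.elim a b) ∧
    (∀ x, Sum.elim a b x ∈ s) ∧ f = diffProd a b}

lemma diffSpan_mono {j : ℕ} {s t : Set τ} (h : s ⊆ t) : diffSpan j s ≤ diffSpan j t :=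
  Submodule.span_mono fun _ ⟨a, b, hab, hs, hf⟩ => ⟨a, b, hab, fun x => h (hs x), hf⟩

lemma sumDeriv_diffProd {j : ℕ} (a b : Fin j → τ) : sumDeriv (diffProd a b) = 0 := by
  induction j with
  | zero => simp [diffProd]
  | succ j ih =>
    have := ih (fun l => a l.succ) fun l => b l.succ
    rw [diffProd] at this ⊢
    rw [Fin.prod_univ_succ, Derivation.leibniz, this]
    simp

lemma diffSpan_le_ker (j : ℕ) (s : Set τ) :
    diffSpan j s ≤ LinearMap.ker (sumDeriv (τ := τ)).toLinearMap := by
  refine Submodule.span_le.2 ?_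
  rintro _ ⟨a, b, _, _, rfl⟩
  exact sumDeriv_diffProd a b

lemma diffProd_mem_sqfree [DecidableEq τ] {j : ℕ} {s : Finset τ} {a b : Fin j → τ}
    (hab : Function.Injective (Sum.elim a b)) (hs : ∀ x, Sum.elim a b x ∈ s) :
    diffProd a b ∈ sqfree j s := by
  induction j generalizing s with
  | zero => simpa [diffProd, mon] using mon_mem_sqfree (Finset.empty_subset s) rfl
  | succ j ih =>
    have hrest : diffProd (fun l => a l.succ) (fun l => b l.succ) ∈
        sqfree j ((s.erase (a 0)).erase (b 0)) := by
      refine ih ?_ ?_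
      · have : Sum.elim (fun l : Fin j => a l.succ) (fun l : Fin j => b l.succ) =
            Sum.elim a b ∘ Sum.map Fin.succ Fin.succ := by
          ext x; cases x <;> rfl
        rw [this]
        exact hab.comp (Sum.map_injective.2 ⟨Fin.succ_injective _, Fin.succ_injective _⟩)
      · rintro (l | l)
        · refine Finset.mem_erase.2 ⟨fun h => ?_, Finset.mem_erase.2 ⟨fun h => ?_,
            hs (Sum.inl l.succ)⟩⟩
          · exact Sum.inl_ne_inr (@hab (Sum.inl l.succ) (Sum.inr 0) h)
          · exact Fin.succ_ne_zero l (Sum.inl_injective (@hab (Sum.inl l.succ) (Sum.inl 0) h))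
        · refine Finset.mem_erase.2 ⟨fun h => ?_, Finset.mem_erase.2 ⟨fun h => ?_,
            hs (Sum.inr l.succ)⟩⟩
          · exact Fin.succ_ne_zero l (Sum.inr_injective (@hab (Sum.inr l.succ) (Sum.inr 0) h))
          · exact Sum.inr_ne_inl (@hab (Sum.inr l.succ) (Sum.inl 0) h)
    have hsub : (s.erase (a 0)).erase (b 0) ⊆ s :=
      (Finset.erase_subset _ _).trans (Finset.erase_subset _ _)
    have ha := X_mul_mem_sqfree (a := a 0) (by simp) hrest
    have hb := X_mul_mem_sqfree (a := b 0) (by simp) hrest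
    rw [diffProd] at ha hb ⊢
    rw [Fin.prod_univ_succ, sub_mul]
    exact sub_mem (sqfree_mono (Finset.insert_subset (hs (Sum.inl 0)) hsub) ha)
      (sqfree_mono (Finset.insert_subset (hs (Sum.inr 0)) hsub) hb)

lemma diffSpan_le_sqfree [DecidableEq τ] (j : ℕ) (s : Finset τ) :
    diffSpan j (s : Set τ) ≤ sqfree j s := by
  refine Submodule.span_le.2 ?_
  rintro _ ⟨a, b, hab, hs, rfl⟩
  exact diffProd_mem_sqfree hab hs

/-- An element of `diffSpan j s` is the coefficient of a new variable `x_a` in an element of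
`diffSpan (j + 1) (insert a s)`, because `s` contains an index different from the `2 * j` ones
involved in a generator. -/
lemma exists_X_mul_add_mem_diffSpan [DecidableEq τ] {j : ℕ} {s : Finset τ} {a : τ} (ha : a ∉ s)
    (hj : 2 * j < s.card) {h : MvPolynomial τ ℂ} (hh : h ∈ diffSpan j (s : Set τ)) :
    ∃ g ∈ sqfree (j + 1) s, X a * h + g ∈ diffSpan (j + 1) (insert a (s : Set τ)) := by
  induction hh using Submodule.span_induction with
  | zero => exact ⟨0, zero_mem _, by simp⟩
  | add x y _ _ hx hy =>
    obtain ⟨g, hg, hgx⟩ := hx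
    obtain ⟨g', hg', hgy⟩ := hy
    refine ⟨g + g', add_mem hg hg', ?_⟩
    rw [show X a * (x + y) + (g + g') = (X a * x + g) + (X a * y + g') by ring]
    exact add_mem hgx hgy
  | smul c x _ hx =>
    obtain ⟨g, hg, hgx⟩ := hx
    refine ⟨c • g, Submodule.smul_mem _ c hg, ?_⟩
    rw [mul_smul_comm, ← smul_add]
    exact Submodule.smul_mem _ c hgx
  | mem x hx =>
    obtain ⟨u, v, huv, hs, rfl⟩ := hx
    obtain ⟨c, hcs, hc⟩ : ∃ c ∈ s, c ∉ Finset.univ.image (Sum.elim u v) := by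
      refine Finset.exists_mem_notMem_of_card_lt_card (Finset.card_image_le.trans_lt ?_)
      simpa [two_mul] using hj
    have hc' : ∀ x, Sum.elim u v x ≠ c := by simpa using hc
    have ha' : ∀ x, Sum.elim u v x ≠ a := fun x h => ha (h ▸ hs x)
    have hX := X_mul_mem_sqfree (a := c) (by simp) (diffProd_mem_sqfree (s := s.erase c) huv
      fun x => Finset.mem_erase.2 ⟨hc' x, hs x⟩)
    rw [Finset.insert_erase hcs] at hX
    refine ⟨-(X c * diffProd u v), Submodule.neg_mem _ hX, ?_⟩
    rw [← sub_eq_add_neg, ← sub_mul]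
    refine Submodule.subset_span ⟨Fin.cons a u, Fin.cons c v, ?_, ?_, ?_⟩
    · have hac : a ≠ c := fun h => ha (h ▸ hcs)
      refine (Function.Injective.sumElim ?_ ?_ ?_)
      · exact Fin.cons_injective_iff.2 ⟨fun ⟨l, hl⟩ => ha' (Sum.inl l) hl,
          huv.comp Sum.inl_injective⟩
      · exact Fin.cons_injective_iff.2 ⟨fun ⟨l, hl⟩ => hc' (Sum.inr l) hl,
          huv.comp Sum.inr_injective⟩
      · intro x y
        refine Fin.cases ?_ (fun x => ?_) x <;> refine Fin.cases ?_ (fun y => ?_) y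
        · simpa using hac
        · simpa using (ha' (Sum.inr y)).symm
        · simpa using hc' (Sum.inl x)
        · simpa using fun h => Sum.inl_ne_inr (@huv (Sum.inl x) (Sum.inr y) h)
    · rintro (l | l)
      · refine Fin.cases ?_ (fun l => ?_) l
        · exact Set.mem_insert _ _
        · exact Set.mem_insert_of_mem _ (hs (Sum.inl l))
      · refine Fin.cases ?_ (fun l => ?_) l
        · exact Set.mem_insert_of_mem _ hcs
        · exact Set.mem_insert_of_mem _ (hs (Sum.inr l))
    · simp [diffProd, Fin.prod_univ_succ]

/-- Up to the middle degree, the squarefree polynomials killed by `∑ i, ∂ / ∂ x_i` are the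
combinations of products of differences. -/
theorem mem_diffSpan_of_sumDeriv_eq_zero [DecidableEq τ] {s : Finset τ} : ∀ {j : ℕ}
    {f : MvPolynomial τ ℂ}, 2 * j ≤ s.card → f ∈ sqfree j s → sumDeriv f = 0 →
    f ∈ diffSpan j (s : Set τ) := by
  have hzero : ∀ {t : Finset τ} {f : MvPolynomial τ ℂ}, f ∈ sqfree 0 t →
      f ∈ diffSpan 0 (t : Set τ) := by
    intro t f hf
    obtain ⟨c, rfl⟩ := mem_sqfree_zero hf
    refine Submodule.smul_mem _ c (Submodule.subset_span ⟨Fin.elim0, Fin.elim0, ?_, ?_, ?_⟩)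
    · rintro (x | x) <;> exact x.elim0
    · rintro (x | x) <;> exact x.elim0
    · simp [diffProd]
  induction s using Finset.induction_on with
  | empty =>
    intro j f hj hf _
    obtain rfl : j = 0 := by simpa using hj
    exact hzero hf
  | insert a s ha ih =>
    intro j f hj hf hDf
    cases j with
    | zero => exact hzero hf
    | succ j =>
      rw [Finset.card_insert_of_notMem ha] at hj
      obtain ⟨g, hg, h, hh, rfl⟩ := exists_eq_add_X_mul hf
      have hDh : sumDeriv h = 0 := by
        rw [map_add, Derivation.leibniz, sumDeriv_X, smul_eq_mul, smul_eq_mul, mul_one,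
          add_comm (X a * _), ← add_assoc] at hDf
        exact (eq_zero_of_add_X_mul_eq_zero ha (add_mem
          (sumDeriv_mem_supported (sqfree_le_supported hg)) (sqfree_le_supported hh)) hDf).2
      obtain ⟨g', hg', hv⟩ := exists_X_mul_add_mem_diffSpan ha (by omega)
        (ih (j := j) (by omega) hh hDh)
      have hD : sumDeriv (g - g') = 0 := by
        have h1 : sumDeriv (X a * h + g') = 0 := diffSpan_le_ker _ _ hv
        rw [show g - g' = (g + X a * h) - (X a * h + g') by ring, map_sub, hDf, h1, sub_zero]
      have hgg : g - g' ∈ diffSpan (j + 1) (s : Set τ) := by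
        -- If `s` is too small for the induction hypothesis, then `2 * j + 1 = s.card`, and
        -- `∑ i, ∂ / ∂ x_i` is injective in degree `j + 1`.
        rcases le_or_gt (2 * (j + 1)) s.card with hc | hc
        · exact ih hc (sub_mem hg hg') hD
        · rw [eq_zero_of_sumDeriv_pow_eq_zero (sub_mem hg hg') (k := 1) (by omega)
            (by simpa using hD)]
          exact zero_mem _
      rw [show g + X a * h = (X a * h + g') + (g - g') by ring, Finset.coe_insert]
      exact add_mem hv (diffSpan_mono (Set.subset_insert _ _) hgg)

theorem diffSpan_eq_inf_ker [DecidableEq τ] {s : Finset τ} {j : ℕ} (hj : 2 * j ≤ s.card) :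
    diffSpan j (s : Set τ) = sqfree j s ⊓ LinearMap.ker (sumDeriv (τ := τ)).toLinearMap :=
  le_antisymm (le_inf (diffSpan_le_sqfree j s) (diffSpan_le_ker j _))
    fun _ hf => mem_diffSpan_of_sumDeriv_eq_zero hj hf.1 hf.2

end Differences

/-! ### The trace on the span of products of differences -/

section DifferencesTrace

variable {n : ℕ}

lemma sumDeriv_polyRep (σ : Perm (Fin n)) (f : MvPolynomial (Fin n) ℂ) :
    sumDeriv (polyRep n σ f) = polyRep n σ (sumDeriv f) := by
  change sumDeriv (rename σ f) = rename σ (sumDeriv f)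
  induction f using MvPolynomial.induction_on with
  | C a =>
    have h : sumDeriv (C a : MvPolynomial (Fin n) ℂ) = 0 := Derivation.map_algebraMap sumDeriv a
    rw [rename_C, h, map_zero]
  | add p q hp hq => simp [hp, hq]
  | mul_X p i hp => simp [Derivation.leibniz, hp]

lemma polyRep_mon (σ : Perm (Fin n)) (S : Finset (Fin n)) :
    polyRep n σ (mon S) = mon (S.map σ.toEmbedding) := by
  change rename σ (mon S) = _
  simp [mon, map_prod]

lemma sqfree_univ (j : ℕ) : sqfree j (Finset.univ : Finset (Fin n)) =
    Submodule.span ℂ (Set.range fun S : {S : Finset (Fin n) // S.card = j} => mon S.1) := by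
  rw [sqfree]
  congr 1
  refine Set.ext fun f => ⟨?_, ?_⟩
  · rintro ⟨S, rfl⟩
    exact ⟨⟨S.1, (Finset.mem_powersetCard.1 S.2).2⟩, rfl⟩
  · rintro ⟨S, rfl⟩
    exact ⟨⟨S.1, Finset.mem_powersetCard.2 ⟨Finset.subset_univ _, S.2⟩⟩, rfl⟩

lemma polyRep_mem_sqfree (σ : Perm (Fin n)) {j : ℕ} {f : MvPolynomial (Fin n) ℂ}
    (hf : f ∈ sqfree j (Finset.univ : Finset (Fin n))) :
    polyRep n σ f ∈ sqfree j (Finset.univ : Finset (Fin n)) := by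
  refine sqfree_induction (p := fun f => polyRep n σ f ∈ sqfree j Finset.univ) ?_ ?_ ?_ ?_ hf
  · intro S _ hj
    rw [polyRep_mon]
    exact mon_mem_sqfree (Finset.subset_univ _) (by rw [Finset.card_map, hj])
  · simp
  · intro f g hf hg
    rw [map_add]
    exact add_mem hf hg
  · intro c f hf
    rw [map_smul]
    exact Submodule.smul_mem _ c hf

/-- The squarefree polynomials of degree `j` form the permutation module on the `j`-subsets. -/
theorem trace_sqfree (σ : Perm (Fin n)) (j : ℕ) :
    LinearMap.trace ℂ (sqfree j (Finset.univ : Finset (Fin n)))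
      ((polyRep n σ).restrict fun _ => polyRep_mem_sqfree σ) =
    (σ.partition.parts.map fun r => 1 + Polynomial.X ^ r :
      Multiset (Polynomial ℂ)).prod.coeff j := by
  have key : ∀ (E : Submodule ℂ (MvPolynomial (Fin n) ℂ)) (hE : ∀ x ∈ E, polyRep n σ x ∈ E),
      E = Submodule.span ℂ (Set.range fun S : {S : Finset (Fin n) // S.card = j} => mon S.1) →
      LinearMap.trace ℂ E ((polyRep n σ).restrict hE) =
      ∑ S : {S : Finset (Fin n) // S.card = j} with S.1.map σ.toEmbedding = S.1, (1 : ℂ) := by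
    rintro _ hE rfl
    rw [trace_restrict_span_range _ (linearIndependent_mon
      (fun S : {S : Finset (Fin n) // S.card = j} => S.1) Subtype.val_injective fun S => S.2) _
      (fun S => ⟨S.1.map σ.toEmbedding, by rw [Finset.card_map, S.2]⟩) (fun _ => 1)
      (fun S => by rw [polyRep_mon, one_smul])]
    simp only [Subtype.ext_iff]
  rw [key _ _ (sqfree_univ j)]
  have := sum_invariant_subsets_card_eq σ (fun _ => (1 : ℂ)) rfl j
  simpa using this

theorem trace_diffSpan (σ : Perm (Fin n)) {j : ℕ} (hj : 2 * j ≤ n)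
    (h : ∀ x ∈ diffSpan j (Set.univ : Set (Fin n)), polyRep n σ x ∈ diffSpan j Set.univ) :
    LinearMap.trace ℂ (diffSpan j (Set.univ : Set (Fin n))) ((polyRep n σ).restrict h) =
    ((1 - Polynomial.X) * (σ.partition.parts.map fun r => 1 + Polynomial.X ^ r :
      Multiset (Polynomial ℂ)).prod).coeff j := by
  have hV := diffSpan_eq_inf_ker (s := (Finset.univ : Finset (Fin n))) (j := j) (by simpa using hj)
  rw [Finset.coe_univ] at hV
  rw [sub_mul, one_mul, Polynomial.coeff_sub, ← trace_sqfree]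
  cases j with
  | zero =>
    have hW : (⊥ : Submodule ℂ (MvPolynomial (Fin n) ℂ)) =
        (sqfree 0 (Finset.univ : Finset (Fin n))).map (sumDeriv (τ := Fin n)).toLinearMap := by
      rw [eq_comm, eq_bot_iff]
      rintro _ ⟨f, hf, rfl⟩
      exact sumDeriv_eq_zero_of_mem_sqfree_zero hf
    rw [trace_restrict_eq_ker_add_map _ _ (sumDeriv_polyRep σ) _ _ _ hV hW _ h (by simp)]
    have : (LinearMap.trace ℂ (⊥ : Submodule ℂ (MvPolynomial (Fin n) ℂ)))
        ((polyRep n σ).restrict (by simp)) = 0 := by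
      rw [Subsingleton.elim ((polyRep n σ).restrict _) 0, map_zero]
    rw [this]
    simp
  | succ j =>
    rw [trace_restrict_eq_ker_add_map _ _ (sumDeriv_polyRep σ) _ _ _ hV
      (map_sumDeriv_sqfree (by simp; omega)).symm _ h (fun _ => polyRep_mem_sqfree σ),
      Polynomial.coeff_X_mul, trace_sqfree, add_sub_cancel_right]

end DifferencesTrace

end SymChar

namespace SymChar

open Equiv MvPolynomial

/-! ### Vandermonde polynomials -/

section Vandermonde

variable {τ : Type*}

/-- The Vandermonde determinant in the variables `x_{a i}`. -/
noncomputable def vdm {m : ℕ} (a : Fin m → τ) : MvPolynomial τ ℂ :=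
  (Matrix.vandermonde fun i => (X (a i) : MvPolynomial τ ℂ)).det

/-- The Vandermonde determinant in the variables `x_{a i}`, multiplied by each of them: the
determinant with entries `x_{a i} ^ (r + 1)`. -/
noncomputable def mvdm {m : ℕ} (a : Fin m → τ) : MvPolynomial τ ℂ :=
  (∏ i, X (a i)) * vdm a

lemma mvdm_eq_det {m : ℕ} (a : Fin m → τ) :
    mvdm a = (Matrix.of fun i r : Fin m => (X (a i) : MvPolynomial τ ℂ) ^ ((r : ℕ) + 1)).det := by
  rw [mvdm, vdm, ← Matrix.det_mul_column]
  congr 1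
  ext1 i r
  simp [Matrix.vandermonde_apply, pow_succ']

lemma rename_vdm {υ : Type*} {m : ℕ} (f : τ → υ) (a : Fin m → τ) :
    rename f (vdm a) = vdm (f ∘ a) := by
  rw [vdm, vdm, AlgHom.map_det]
  congr 1
  ext1 i r
  simp [Matrix.vandermonde_apply]

lemma rename_mvdm {υ : Type*} {m : ℕ} (f : τ → υ) (a : Fin m → τ) :
    rename f (mvdm a) = mvdm (f ∘ a) := by
  simp [mvdm, rename_vdm]

lemma mvdm_comp_perm {m : ℕ} (a : Fin m → τ) (π : Perm (Fin m)) :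
    mvdm (a ∘ π) = (((Perm.sign π : ℤˣ) : ℤ) : ℂ) • mvdm a := by
  have h := Matrix.det_permute π (Matrix.vandermonde fun i => (X (a i) : MvPolynomial τ ℂ))
  have h' : vdm (a ∘ π) = (((Perm.sign π : ℤˣ) : ℤ) : MvPolynomial τ ℂ) * vdm a := h
  have hprod : ∏ i, (X ((a ∘ π) i) : MvPolynomial τ ℂ) = ∏ i, X (a i) :=
    Equiv.prod_comp π fun i => (X (a i) : MvPolynomial τ ℂ)
  rw [mvdm, mvdm, h', hprod, smul_eq_C_mul, map_intCast]
  ring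

/-- Expansion of a Vandermonde determinant along its constant column. -/
lemma vdm_eq_sum {m : ℕ} (a : Fin (m + 1) → τ) :
    vdm a = ∑ i : Fin (m + 1), ((-1 : ℂ) ^ (i : ℕ)) • mvdm (a ∘ i.succAbove) := by
  rw [vdm, Matrix.det_succ_column_zero]
  refine Finset.sum_congr rfl fun i _ => ?_
  rw [mvdm_eq_det, Matrix.vandermonde_apply, smul_eq_C_mul]
  simp only [Fin.val_zero, pow_zero, mul_one, map_pow, map_neg, map_one]
  congr 2

lemma vdm_eq_prod {m : ℕ} (a : Fin m → τ) :
    vdm a = ∏ i, ∏ j ∈ Finset.Ioi i, (X (a j) - X (a i)) :=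
  Matrix.det_vandermonde _

lemma vdm_ne_zero {m : ℕ} {a : Fin m → τ} (ha : Function.Injective a) : vdm a ≠ 0 :=
  Matrix.det_vandermonde_ne_zero_iff.2 ((X_injective (R := ℂ)).comp ha)

lemma vdm_mem_supported {m : ℕ} {a : Fin m → τ} {s : Set τ} (ha : ∀ i, a i ∈ s) :
    vdm a ∈ supported ℂ s := by
  rw [vdm_eq_prod]
  exact Subalgebra.prod_mem _ fun i _ => Subalgebra.prod_mem _ fun j _ =>
    sub_mem (X_mem_supported.2 (ha j)) (X_mem_supported.2 (ha i))

/-! ### Lowering the exponents of monomials -/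

/-- The linear operator that lowers by one each positive exponent of a monomial. -/
noncomputable def lower : MvPolynomial τ ℂ →ₗ[ℂ] MvPolynomial τ ℂ :=
  (basisMonomials τ ℂ).constr ℂ fun m => monomial (m.mapRange Nat.pred rfl) 1

lemma lower_monomial (m : τ →₀ ℕ) :
    lower (monomial m 1) = monomial (m.mapRange Nat.pred rfl) (1 : ℂ) := by
  have := (basisMonomials τ ℂ).constr_basis ℂ
    (fun m => (monomial (m.mapRange Nat.pred rfl) 1 : MvPolynomial τ ℂ)) m
  rwa [coe_basisMonomials] at this

lemma lower_rename {υ : Type*} (f : τ ↪ υ) (p : MvPolynomial τ ℂ) :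
    lower (rename f p) = rename f (lower p) := by
  have : lower ∘ₗ (rename f : MvPolynomial τ ℂ →ₐ[ℂ] _).toLinearMap =
      (rename f : MvPolynomial τ ℂ →ₐ[ℂ] _).toLinearMap ∘ₗ lower := by
    refine (basisMonomials τ ℂ).ext fun m => ?_
    simp only [coe_basisMonomials, LinearMap.comp_apply, AlgHom.toLinearMap_apply, lower_monomial,
      rename_monomial]
    rw [← Finsupp.embDomain_eq_mapDomain, ← Finsupp.embDomain_eq_mapDomain,
      Finsupp.embDomain_mapRange]
  exact LinearMap.congr_fun this p

lemma prod_X_pow_eq_monomial_of_fintype [Fintype τ] (e : τ → ℕ) :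
    ∏ i, (X i : MvPolynomial τ ℂ) ^ e i = monomial (Finsupp.equivFunOnFinite.symm e) 1 := by
  rw [monomial_eq, Finsupp.prod_fintype _ _ (by simp)]
  simp

lemma lower_mvdm {m : ℕ} {a : Fin m → τ} (ha : Function.Injective a) :
    lower (mvdm a) = vdm a := by
  have key : lower (mvdm (id : Fin m → Fin m)) = vdm id := by
    rw [mvdm_eq_det, vdm, Matrix.det_apply, Matrix.det_apply, map_sum]
    refine Finset.sum_congr rfl fun π _ => ?_
    have h1 : ∀ e : Fin m → ℕ, ∏ i, (X (π i) : MvPolynomial (Fin m) ℂ) ^ e i =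
        monomial (Finsupp.equivFunOnFinite.symm (e ∘ π.symm)) 1 := by
      intro e
      rw [← prod_X_pow_eq_monomial_of_fintype, ← Equiv.prod_comp π fun i =>
        (X i : MvPolynomial (Fin m) ℂ) ^ (e ∘ π.symm) i]
      simp
    simp only [Matrix.of_apply, Matrix.vandermonde_apply, id, Units.smul_def, map_zsmul]
    rw [h1, h1, lower_monomial]
    congr 3
    ext i
    simp
  have h := lower_rename ⟨a, ha⟩ (mvdm (id : Fin m → Fin m))
  rw [key, rename_mvdm, rename_vdm] at h
  exact h

/-- `lower` kills Vandermonde determinants: it turns them into determinants with two constant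
columns. -/
lemma lower_vdm {m : ℕ} {a : Fin (m + 2) → τ} (ha : Function.Injective a) : lower (vdm a) = 0 := by
  rw [vdm_eq_sum, map_sum]
  let B : Matrix (Fin (m + 2)) (Fin (m + 2)) (MvPolynomial τ ℂ) :=
    Matrix.of fun i => Fin.cons 1 fun r => X (a i) ^ (r : ℕ)
  have hB : B.det = 0 := Matrix.det_zero_of_column_eq (i := 0) (j := 1) (by simp) fun i => by
    simp only [B, Matrix.of_apply, Fin.cons_zero]
    rw [show (1 : Fin (m + 2)) = Fin.succ 0 from rfl, Fin.cons_succ]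
    simp
  rw [← hB, Matrix.det_succ_column_zero]
  refine Finset.sum_congr rfl fun i _ => ?_
  rw [map_smul, lower_mvdm (ha.comp Fin.succAbove_right_injective), smul_eq_C_mul]
  simp only [B, Matrix.of_apply, Fin.cons_zero, mul_one, map_pow, map_neg, map_one]
  congr 2

end Vandermonde

/-! ### The span of the Vandermonde polynomials -/

section VandermondeSpan

variable {n : ℕ}

/-- The span of the Vandermonde determinants in `m` distinct variables. -/
noncomputable def vdmSpan (n m : ℕ) : Submodule ℂ (MvPolynomial (Fin n) ℂ) :=
  Submodule.span ℂ {f | ∃ a : Fin m → Fin n, Function.Injective a ∧ f = vdm a}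

/-- The polynomial `mvdm` for the increasing enumeration of `S`. -/
noncomputable def mvdmOf {m : ℕ} (S : {S : Finset (Fin n) // S.card = m}) :
    MvPolynomial (Fin n) ℂ :=
  mvdm (S.1.orderEmbOfFin S.2)

/-- The span of the polynomials `mvdm` in `m` distinct variables, a model for the `m`-th exterior
power of the permutation module. -/
noncomputable def mvdmSpan (n m : ℕ) : Submodule ℂ (MvPolynomial (Fin n) ℂ) :=
  Submodule.span ℂ (Set.range fun S : {S : Finset (Fin n) // S.card = m} => mvdmOf S)

instance (m : ℕ) : FiniteDimensional ℂ (mvdmSpan n m) :=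
  FiniteDimensional.span_of_finite ℂ (Set.finite_range _)

lemma mvdmOf_eq {m : ℕ} (S : {S : Finset (Fin n) // S.card = m}) :
    mvdmOf S = mon S.1 * vdm (S.1.orderEmbOfFin S.2) := by
  rw [mvdmOf, mvdm, mon]
  congr 1
  conv_rhs => rw [← Finset.map_orderEmbOfFin_univ S.1 S.2]
  rw [Finset.prod_map]
  rfl

lemma exists_mvdm_eq_smul {m : ℕ} {a : Fin m → Fin n} (ha : Function.Injective a)
    (S : {S : Finset (Fin n) // S.card = m}) (hS : ∀ i, a i ∈ S.1) :
    ∃ ε : ℂ, mvdm a = ε • mvdmOf S := by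
  let g : Fin m → Fin m := fun i => (S.1.orderIsoOfFin S.2).symm ⟨a i, hS i⟩
  have hg : Function.Injective g := fun i j h => ha (by simpa [g] using h)
  have hag : a = S.1.orderEmbOfFin S.2 ∘
      Equiv.ofBijective g (Finite.injective_iff_bijective.1 hg) := by
    ext1 i
    simp only [Function.comp_apply, Equiv.ofBijective_apply, g]
    rw [← Finset.coe_orderIsoOfFin_apply, OrderIso.apply_symm_apply]
  exact ⟨_, by rw [hag, mvdm_comp_perm]; rfl⟩

lemma mvdm_mem_mvdmSpan {m : ℕ} {a : Fin m → Fin n} (ha : Function.Injective a) :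
    mvdm a ∈ mvdmSpan n m := by
  obtain ⟨ε, h⟩ := exists_mvdm_eq_smul ha ⟨Finset.univ.image a, by
    rw [Finset.card_image_of_injective _ ha, Finset.card_fin]⟩ (by simp)
  rw [h]
  exact Submodule.smul_mem _ _ (Submodule.subset_span ⟨_, rfl⟩)

lemma linearIndependent_mvdmOf (m : ℕ) :
    LinearIndependent ℂ fun S : {S : Finset (Fin n) // S.card = m} => mvdmOf S := by
  simp_rw [mvdmOf_eq]
  exact linearIndependent_mon_mul (fun S : {S : Finset (Fin n) // S.card = m} => S.1)
    Subtype.val_injective (fun S => S.2) _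
    (fun S => vdm_mem_supported fun i => Finset.orderEmbOfFin_mem S.1 S.2 i)
    fun S => vdm_ne_zero (S.1.orderEmbOfFin S.2).injective

lemma finrank_mvdmSpan (m : ℕ) : Module.finrank ℂ (mvdmSpan n m) = n.choose m := by
  rw [mvdmSpan, finrank_span_eq_card (linearIndependent_mvdmOf m), Fintype.card_finset_len,
    Fintype.card_fin]

lemma vdmSpan_le_mvdmSpan (m : ℕ) : vdmSpan n (m + 1) ≤ mvdmSpan n m := by
  refine Submodule.span_le.2 ?_
  rintro _ ⟨a, ha, rfl⟩
  rw [vdm_eq_sum]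
  exact Submodule.sum_mem _ fun i _ => Submodule.smul_mem _ _
    (mvdm_mem_mvdmSpan (ha.comp Fin.succAbove_right_injective))

instance (m : ℕ) : FiniteDimensional ℂ (vdmSpan n (m + 1)) :=
  Submodule.finiteDimensional_of_le (vdmSpan_le_mvdmSpan m)

lemma map_lower_mvdmSpan (m : ℕ) : (mvdmSpan n m).map lower = vdmSpan n m := by
  refine le_antisymm ?_ ?_
  · rw [mvdmSpan, Submodule.map_span, Submodule.span_le]
    rintro _ ⟨_, ⟨S, rfl⟩, rfl⟩
    exact Submodule.subset_span ⟨_, (S.1.orderEmbOfFin S.2).injective,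
      lower_mvdm (S.1.orderEmbOfFin S.2).injective⟩
  · refine Submodule.span_le.2 ?_
    rintro _ ⟨a, ha, rfl⟩
    exact ⟨_, mvdm_mem_mvdmSpan ha, lower_mvdm ha⟩

/-- The Vandermonde determinants involving the variable `x_p` contribute a family of independent
vectors, as the substitution `x_p = 0` shows. -/
lemma choose_le_finrank_vdmSpan (m : ℕ) :
    n.choose m ≤ Module.finrank ℂ (vdmSpan (n + 1) (m + 1)) := by
  let ι := {S : Finset (Fin (n + 1)) // S ∈ (Finset.univ.erase 0).powersetCard m}
  have hcard : ∀ S : ι, S.1.card = m := fun S => (Finset.mem_powersetCard.1 S.2).2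
  have h0 : ∀ S : ι, 0 ∉ S.1 := fun S h => by
    simpa using (Finset.mem_powersetCard.1 S.2).1 h
  have hne : ∀ (S : ι) i, S.1.orderEmbOfFin (hcard S) i ≠ 0 := fun S i h => by
    have := Finset.orderEmbOfFin_mem S.1 (hcard S) i
    rw [h] at this
    exact h0 S this
  let v : ι → MvPolynomial (Fin (n + 1)) ℂ := fun S =>
    vdm (Fin.cons 0 (S.1.orderEmbOfFin (hcard S)) : Fin (m + 1) → Fin (n + 1))
  have hv : ∀ S, v S ∈ vdmSpan (n + 1) (m + 1) := fun S => Submodule.subset_span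
    ⟨_, Fin.cons_injective_iff.2 ⟨fun ⟨i, hi⟩ => hne S i hi,
      (S.1.orderEmbOfFin (hcard S)).injective⟩, rfl⟩
  have hk : ∀ S, keepVars (Finset.univ.erase 0) (v S) = mvdmOf ⟨S.1, hcard S⟩ := by
    intro S
    have hX : ∀ i, keepVars (Finset.univ.erase 0)
        (X (S.1.orderEmbOfFin (hcard S) i) : MvPolynomial (Fin (n + 1)) ℂ) =
        X (S.1.orderEmbOfFin (hcard S) i) := fun i => by simp [keepVars, hne S i]
    have hX0 : keepVars (Finset.univ.erase 0) (X 0 : MvPolynomial (Fin (n + 1)) ℂ) = 0 := by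
      simp [keepVars]
    simp only [v, vdm_eq_prod, mvdmOf, mvdm, Fin.prod_univ_succ, Fin.prod_Ioi_zero,
      Fin.prod_Ioi_succ, Fin.cons_zero, Fin.cons_succ, map_mul, map_prod, map_sub,
      hX, hX0, sub_zero]
  have hli : LinearIndependent ℂ fun S : ι => (⟨v S, hv S⟩ : vdmSpan (n + 1) (m + 1)) := by
    refine LinearIndependent.of_comp
      ((keepVars (Finset.univ.erase 0)).toLinearMap ∘ₗ (vdmSpan (n + 1) (m + 1)).subtype) ?_
    have : (((keepVars (Finset.univ.erase 0)).toLinearMap ∘ₗ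
        (vdmSpan (n + 1) (m + 1)).subtype) ∘ fun S : ι => ⟨v S, hv S⟩) =
        (fun S : {S : Finset (Fin (n + 1)) // S.card = m} => mvdmOf S) ∘
          fun S : ι => ⟨S.1, hcard S⟩ := funext hk
    rw [this]
    exact (linearIndependent_mvdmOf m).comp _ fun S T h => Subtype.ext (congrArg (·.1) h)
  have := hli.fintype_card_le_finrank
  rw [Fintype.card_coe, Finset.card_powersetCard, Finset.card_erase_of_mem (Finset.mem_univ _),
    Finset.card_fin] at this
  exact this

/-- The Koszul complex of the `mvdmSpan n m` is exact: the kernel contains `vdmSpan`, and the lower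
bounds for the dimensions of kernel and image add up to the dimension of the source. -/
theorem vdmSpan_eq_inf_ker (m : ℕ) :
    vdmSpan (n + 1) (m + 2) = mvdmSpan (n + 1) (m + 1) ⊓ LinearMap.ker lower := by
  have hle : vdmSpan (n + 1) (m + 2) ≤ mvdmSpan (n + 1) (m + 1) ⊓ LinearMap.ker lower := by
    refine le_inf (vdmSpan_le_mvdmSpan _) (Submodule.span_le.2 ?_)
    rintro _ ⟨a, ha, rfl⟩
    exact lower_vdm ha
  have : FiniteDimensional ℂ (mvdmSpan (n + 1) (m + 1) ⊓ LinearMap.ker lower :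
      Submodule ℂ (MvPolynomial (Fin (n + 1)) ℂ)) := Submodule.finiteDimensional_inf_left _ _
  refine Submodule.eq_of_le_of_finrank_le hle ?_
  have h1 := choose_le_finrank_vdmSpan (n := n) m
  have h2 : n.choose (m + 1) ≤ Module.finrank ℂ (vdmSpan (n + 1) (m + 2)) :=
    choose_le_finrank_vdmSpan (m + 1)
  have h3 : Module.finrank ℂ (mvdmSpan (n + 1) (m + 1)) = n.choose m + n.choose (m + 1) :=
    finrank_mvdmSpan _
  have h4 := (lower.domRestrict (mvdmSpan (n + 1) (m + 1))).finrank_range_add_finrank_ker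
  rw [LinearMap.range_domRestrict, map_lower_mvdmSpan] at h4
  have h5 := Submodule.finrank_map_subtype_eq (mvdmSpan (n + 1) (m + 1))
    (LinearMap.ker (lower.domRestrict (mvdmSpan (n + 1) (m + 1))))
  have h6 : LinearMap.ker (lower.domRestrict (mvdmSpan (n + 1) (m + 1))) =
      (LinearMap.ker lower).comap (mvdmSpan (n + 1) (m + 1)).subtype := rfl
  rw [h6, Submodule.map_comap_subtype, ← h6] at h5
  omega

/-! ### The trace on the span of the Vandermonde polynomials -/

lemma polyRep_vdm {m : ℕ} (σ : Perm (Fin n)) (a : Fin m → Fin n) :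
    polyRep n σ (vdm a) = vdm (σ ∘ a) :=
  rename_vdm σ a

lemma polyRep_mvdm {m : ℕ} (σ : Perm (Fin n)) (a : Fin m → Fin n) :
    polyRep n σ (mvdm a) = mvdm (σ ∘ a) :=
  rename_mvdm σ a

lemma lower_polyRep (σ : Perm (Fin n)) (f : MvPolynomial (Fin n) ℂ) :
    lower (polyRep n σ f) = polyRep n σ (lower f) :=
  lower_rename σ.toEmbedding f

lemma polyRep_mem_vdmSpan (σ : Perm (Fin n)) {m : ℕ} {f : MvPolynomial (Fin n) ℂ}
    (hf : f ∈ vdmSpan n m) : polyRep n σ f ∈ vdmSpan n m := by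
  refine (Submodule.span_le (p := (vdmSpan n m).comap (polyRep n σ))).2 ?_ hf
  rintro _ ⟨a, ha, rfl⟩
  exact Submodule.subset_span ⟨σ ∘ a, σ.injective.comp ha, polyRep_vdm σ a⟩

lemma polyRep_mem_mvdmSpan (σ : Perm (Fin n)) {m : ℕ} {f : MvPolynomial (Fin n) ℂ}
    (hf : f ∈ mvdmSpan n m) : polyRep n σ f ∈ mvdmSpan n m := by
  refine (Submodule.span_le (p := (mvdmSpan n m).comap (polyRep n σ))).2 ?_ hf
  rintro _ ⟨S, rfl⟩
  have h := mvdm_mem_mvdmSpan (σ.injective.comp (S.1.orderEmbOfFin S.2).injective)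
  rwa [← polyRep_mvdm] at h

/-- A permutation permutes the polynomials `mvdmOf S` up to sign; for an invariant set `S` the sign
is that of the induced permutation of `S`. -/
lemma exists_polyRep_mvdmOf {m : ℕ} (σ : Perm (Fin n)) (S : {S : Finset (Fin n) // S.card = m}) :
    ∃ ε : ℂ, polyRep n σ (mvdmOf S) =
        ε • mvdmOf ⟨S.1.map σ.toEmbedding, by rw [Finset.card_map, S.2]⟩ ∧
      ∀ hS : ∀ x, σ x ∈ S.1 ↔ x ∈ S.1, ε = (((Perm.sign (σ.subtypePerm hS) : ℤˣ) : ℤ) : ℂ) := by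
  by_cases hS : ∀ x, σ x ∈ S.1 ↔ x ∈ S.1
  · refine ⟨(((Perm.sign (σ.subtypePerm hS) : ℤˣ) : ℤ) : ℂ), ?_, fun _ => rfl⟩
    have hmap : (⟨S.1.map σ.toEmbedding, by rw [Finset.card_map, S.2]⟩ :
        {S : Finset (Fin n) // S.card = m}) = S :=
      Subtype.ext ((map_perm_eq_self_iff σ S.1).2 fun x => (hS x).symm)
    rw [hmap]
    let π : Perm (Fin m) := (S.1.orderIsoOfFin S.2).toEquiv.symm.permCongr (σ.subtypePerm hS)
    have hπ : σ ∘ S.1.orderEmbOfFin S.2 = S.1.orderEmbOfFin S.2 ∘ π := by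
      ext1 i
      simp only [Function.comp_apply, ← Finset.coe_orderIsoOfFin_apply]
      simp [π]
    rw [mvdmOf, polyRep_mvdm, hπ, mvdm_comp_perm, Perm.sign_permCongr]
  · obtain ⟨ε, h⟩ := exists_mvdm_eq_smul (σ.injective.comp (S.1.orderEmbOfFin S.2).injective)
      ⟨S.1.map σ.toEmbedding, by rw [Finset.card_map, S.2]⟩
      (fun i => Finset.mem_map_of_mem _ (Finset.orderEmbOfFin_mem S.1 S.2 i))
    exact ⟨ε, by rw [mvdmOf, polyRep_mvdm, h], fun h => (hS h).elim⟩

/-- The characters of the exterior powers of the permutation module: a cycle of length `r` acts on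
the top exterior power of its support by `(-1) ^ (r + 1)`. -/
theorem trace_mvdmSpan (σ : Perm (Fin n)) (m : ℕ) :
    LinearMap.trace ℂ (mvdmSpan n m) ((polyRep n σ).restrict fun _ => polyRep_mem_mvdmSpan σ) =
    (σ.partition.parts.map fun r => 1 + Polynomial.C ((-1) ^ (r + 1)) * Polynomial.X ^ r :
      Multiset (Polynomial ℂ)).prod.coeff m := by
  choose ε hε hεS using exists_polyRep_mvdmOf (m := m) σ
  have h1 := trace_restrict_span_range _ (linearIndependent_mvdmOf m) (polyRep n σ)
    (fun S => ⟨S.1.map σ.toEmbedding, by rw [Finset.card_map, S.2]⟩) ε hε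
    (fun _ => polyRep_mem_mvdmSpan σ)
  refine h1.trans ?_
  rw [← sum_invariant_subsets_card_eq σ (fun r => (-1 : ℂ) ^ (r + 1)) (by norm_num)]
  simp only [Subtype.ext_iff]
  refine Finset.sum_congr rfl fun S hS => ?_
  have hS' := (map_perm_eq_self_iff σ S.1).1 (Finset.mem_filter.1 hS).2
  rw [hεS S fun x => (hS' x).symm, sign_subtypePerm_eq_prod]
  push_cast
  rfl

/-- Consecutive spans of Vandermonde determinants add up, in traces, to an exterior power; this is
the division by `1 + X` of the generating function of the exterior powers. -/
theorem trace_vdmSpan (σ : Perm (Fin (n + 1))) (F : Polynomial ℂ)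
    (hF : (σ.partition.parts.map fun r => 1 + Polynomial.C ((-1) ^ (r + 1)) * Polynomial.X ^ r :
      Multiset (Polynomial ℂ)).prod = (1 + Polynomial.X) * F) (m : ℕ) :
    LinearMap.trace ℂ (vdmSpan (n + 1) (m + 1))
      ((polyRep (n + 1) σ).restrict fun _ => polyRep_mem_vdmSpan σ) = F.coeff m := by
  induction m with
  | zero =>
    have key : ∀ (E : Submodule ℂ (MvPolynomial (Fin (n + 1)) ℂ))
        (hE : ∀ x ∈ E, polyRep (n + 1) σ x ∈ E), E = mvdmSpan (n + 1) 0 →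
        LinearMap.trace ℂ E ((polyRep (n + 1) σ).restrict hE) = F.coeff 0 := by
      rintro _ hE rfl
      rw [trace_mvdmSpan, hF]
      simp [Polynomial.mul_coeff_zero]
    refine key _ _ (Submodule.eq_of_le_of_finrank_le (vdmSpan_le_mvdmSpan 0) ?_)
    rw [finrank_mvdmSpan]
    simpa using choose_le_finrank_vdmSpan (n := n) 0
  | succ m ih =>
    have h := trace_restrict_eq_ker_add_map _ _ (lower_polyRep σ) _ _ _ (vdmSpan_eq_inf_ker m)
      (map_lower_mvdmSpan (m + 1)).symm (fun _ => polyRep_mem_mvdmSpan σ)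
      (fun _ => polyRep_mem_vdmSpan σ) (fun _ => polyRep_mem_vdmSpan σ)
    rw [ih, trace_mvdmSpan, hF, add_mul, one_mul, Polynomial.coeff_add, Polynomial.coeff_X_mul] at h
    exact (add_right_cancel h).symm

end VandermondeSpan

end SymChar

namespace SymChar

open Equiv MvPolynomial

/-! ### Tableaux and Specht polynomials -/

lemma card_cellsOfRowLens (w : List ℕ) : (YoungDiagram.cellsOfRowLens w).card = w.sum := by
  induction w with
  | nil => rfl
  | cons a w ih =>
    rw [YoungDiagram.cellsOfRowLens, Finset.card_union_of_disjoint, Finset.card_map, ih]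
    · simp
    · rw [Finset.disjoint_left]
      rintro ⟨r, c⟩ h1 h2
      simp only [Finset.mem_product, Finset.mem_singleton, Finset.mem_map] at h1 h2
      obtain ⟨⟨r', c'⟩, -, h⟩ := h2
      have := congrArg Prod.fst h
      simp at this
      omega

lemma card_cells_diagram {n : ℕ} (p : n.Partition) : (diagram p).cells.card = n := by
  have h : (p.parts.sort (· ≥ ·)).sum = n := by
    rw [← Multiset.sum_coe, Multiset.sort_eq, p.parts_sum]
  exact (card_cellsOfRowLens _).trans h

/-- A filling of some cells by distinct numbers extends to a tableau. -/
lemma exists_tableau_extending {n : ℕ} {p : n.Partition} {ι : Type*} {f : ι → (diagram p).cells}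
    (hf : Function.Injective f) {g : ι → Fin n} (hg : Function.Injective g) :
    ∃ T : Tableau p, ∀ i, T (f i) = g i := by
  classical
  let T₀ : Tableau p := (diagram p).cells.equivFinOfCardEq (card_cells_diagram p)
  have hT₀ : Function.Injective (T₀ ∘ f) := T₀.injective.comp hf
  let e : {x // x ∈ Set.range (T₀ ∘ f)} ≃ {x // x ∈ Set.range g} :=
    (Equiv.ofInjective _ hT₀).symm.trans (Equiv.ofInjective _ hg)
  refine ⟨T₀.trans e.extendSubtype, fun i => ?_⟩
  have h := e.extendSubtype_apply_of_mem (T₀ (f i)) ⟨i, rfl⟩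
  have h' : (⟨T₀ (f i), ⟨i, rfl⟩⟩ : {x // x ∈ Set.range (T₀ ∘ f)}) =
      Equiv.ofInjective _ hT₀ i := rfl
  rw [Equiv.trans_apply, h, h', Equiv.trans_apply, Equiv.symm_apply_apply]
  rfl

lemma spechtPolynomial_eq_prod_pairs {n : ℕ} {p : n.Partition} (T : Tableau p) :
    spechtPolynomial T = ∏ x : (diagram p).cells × (diagram p).cells with
      x.1.1.2 = x.2.1.2 ∧ x.1.1.1 < x.2.1.1, (X (T x.1) - X (T x.2)) := by
  simp only [spechtPolynomial, Finset.prod_filter]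
  rw [Fintype.prod_prod_type]

lemma mem_diagram_iff {n : ℕ} {p : n.Partition} {L : List ℕ} (h : p.parts = (L : Multiset ℕ))
    (hL : L.Pairwise (· ≥ ·)) (c : ℕ × ℕ) :
    c ∈ (diagram p).cells ↔ ∃ h : c.1 < L.length, c.2 < L[c.1] := by
  have hs : p.parts.sort (· ≥ ·) = L := by
    refine List.Perm.eq_of_pairwise' (r := (· ≥ ·)) (Multiset.pairwise_sort _ _) hL ?_
    rw [← Multiset.coe_eq_coe, Multiset.sort_eq, h]
  rw [YoungDiagram.mem_cells, diagram, YoungDiagram.mem_ofRowLens]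
  simp only [hs]

/-! ### Two-rowed shapes -/

lemma mem_diagram_twoRowed {n : ℕ} (j : Fin (n / 2 + 1)) (c : ℕ × ℕ) :
    c ∈ (diagram (twoRowed n j)).cells ↔
      (c.1 = 0 ∧ c.2 < n - j) ∨ (c.1 = 1 ∧ c.2 < (j : ℕ)) := by
  obtain ⟨j, hj⟩ := j
  obtain ⟨r, c⟩ := c
  have hparts : (twoRowed n ⟨j, hj⟩).parts = Multiset.filter (· ≠ 0) {n - j, j} := rfl
  simp only
  rcases Nat.eq_zero_or_pos j with rfl | hj0
  · rcases Nat.eq_zero_or_pos n with rfl | hn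
    · rw [mem_diagram_iff (L := []) (by rw [hparts]; simp) (by simp)]
      simp
    · rw [mem_diagram_iff (L := [n]) (by rw [hparts]; simp [hn.ne', Multiset.filter_singleton])
        (by simp)]
      simp
  · rw [mem_diagram_iff (L := [n - j, j]) ?_ (by simp; omega)]
    · rcases r with _ | _ | r <;> simp
    · rw [hparts, Multiset.filter_eq_self.2]
      · rfl
      · simp; omega

theorem spechtModule_twoRowed {n : ℕ} (j : Fin (n / 2 + 1)) :
    (spechtModule (twoRowed n j)).toSubmodule = diffSpan (j : ℕ) Set.univ := by
  have hmem := mem_diagram_twoRowed j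
  have hj : (j : ℕ) ≤ n - j := by have := j.2; omega
  let f : Fin j ⊕ Fin j → (diagram (twoRowed n j)).cells := Sum.elim
    (fun l => ⟨(0, l), (hmem _).2 (Or.inl ⟨rfl, l.2.trans_le hj⟩)⟩)
    (fun l => ⟨(1, l), (hmem _).2 (Or.inr ⟨rfl, l.2⟩)⟩)
  have hf : Function.Injective f := by
    rintro (l | l) (l' | l') h <;> simp_all [f, Fin.ext_iff]
  have hS : ∀ T : Tableau (twoRowed n j), spechtPolynomial T =
      diffProd (fun l => T (f (Sum.inl l))) fun l => T (f (Sum.inr l)) := by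
    intro T
    rw [spechtPolynomial_eq_prod_pairs, diffProd]
    symm
    refine Finset.prod_nbij (fun l => (f (Sum.inl l), f (Sum.inr l))) ?_ ?_ ?_ (fun _ _ => rfl)
    · intro l _
      simp [f]
    · intro l _ l' _ h
      exact Sum.inl_injective (hf (congrArg Prod.fst h))
    · rintro ⟨⟨⟨r, c⟩, h1⟩, ⟨⟨r', c'⟩, h2⟩⟩ h
      simp only [Finset.coe_filter, Finset.mem_univ, true_and, Set.mem_ofPred_eq] at h
      obtain ⟨rfl, hr⟩ := h
      rw [hmem] at h1 h2
      simp only at h1 h2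
      obtain ⟨rfl, hc⟩ : r' = 1 ∧ c < j := by omega
      obtain rfl : r = 0 := by omega
      exact ⟨⟨c, hc⟩, by simp, rfl⟩
  change Submodule.span ℂ _ = Submodule.span ℂ _
  congr 1
  ext x
  constructor
  · rintro ⟨T, rfl⟩
    refine ⟨_, _, ?_, fun _ => Set.mem_univ _, hS T⟩
    have : Sum.elim (fun l => T (f (Sum.inl l))) (fun l => T (f (Sum.inr l))) = T ∘ f := by
      ext1 x; cases x <;> rfl
    rw [this]
    exact T.injective.comp hf
  · rintro ⟨a, b, hab, -, rfl⟩
    obtain ⟨T, hT⟩ := exists_tableau_extending hf hab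
    refine ⟨T, ?_⟩
    simp only
    rw [hS]
    congr 1
    · ext1 l; exact hT (Sum.inl l)
    · ext1 l; exact hT (Sum.inr l)

/-! ### Hooks -/

lemma mem_diagram_hook {n : ℕ} (j : Fin n) (c : ℕ × ℕ) :
    c ∈ (diagram (hook n j)).cells ↔
      (c.1 = 0 ∧ c.2 < j + 1) ∨ (c.2 = 0 ∧ c.1 < n - j) := by
  obtain ⟨j, hj⟩ := j
  obtain ⟨r, c⟩ := c
  have hparts : (hook n ⟨j, hj⟩).parts =
      Multiset.filter (· ≠ 0) ((j + 1) ::ₘ Multiset.replicate (n - (j + 1)) 1) := rfl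
  rw [mem_diagram_iff (L := (j + 1) :: List.replicate (n - (j + 1)) 1)]
  · cases r with
    | zero => simp; omega
    | succ r => simp; omega
  · rw [hparts, Multiset.filter_eq_self.2]
    · rw [← Multiset.cons_coe, Multiset.coe_replicate]
    · intro x hx
      rcases Multiset.mem_cons.1 hx with rfl | hx
      · omega
      · rw [Multiset.eq_of_mem_replicate hx]; omega
  · rw [List.pairwise_cons]
    refine ⟨fun x hx => ?_, List.pairwise_replicate.2 (Or.inr le_rfl)⟩
    rw [List.eq_of_mem_replicate hx]
    omega

theorem spechtModule_hook {n : ℕ} (j : Fin n) :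
    (spechtModule (hook n j)).toSubmodule = vdmSpan n (n - j) := by
  have hmem := mem_diagram_hook j
  -- Listing the first column from bottom to top matches the signs in `vdm`.
  let f : Fin (n - j) → (diagram (hook n j)).cells :=
    fun l => ⟨(l.rev, 0), (hmem _).2 (Or.inr ⟨rfl, l.rev.2⟩)⟩
  have hf : Function.Injective f := by
    intro l l' h
    simpa [f, -Fin.val_rev, Fin.val_inj] using h
  have hS : ∀ T : Tableau (hook n j), spechtPolynomial T = vdm fun l => T (f l) := by
    intro T
    rw [spechtPolynomial_eq_prod_pairs, vdm_eq_prod, Finset.prod_sigma']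
    symm
    refine Finset.prod_nbij (fun x => (f x.2, f x.1)) ?_ ?_ ?_ (fun _ _ => rfl)
    · rintro ⟨l, l'⟩ h
      simp only [Finset.mem_sigma, Finset.mem_univ, true_and, Finset.mem_Ioi] at h
      simpa [f, -Fin.val_rev] using h
    · rintro ⟨l, l'⟩ _ ⟨k, k'⟩ _ h
      obtain rfl := hf (congrArg Prod.fst h)
      obtain rfl := hf (congrArg Prod.snd h)
      rfl
    · rintro ⟨⟨⟨r, c⟩, h1⟩, ⟨⟨r', c'⟩, h2⟩⟩ h
      simp only [Finset.coe_filter, Finset.mem_univ, true_and, Set.mem_ofPred_eq] at h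
      obtain ⟨rfl, hr⟩ := h
      rw [hmem] at h1 h2
      simp only at h1 h2
      obtain ⟨rfl, hr'⟩ : c = 0 ∧ r' < n - j := by omega
      refine ⟨⟨Fin.rev ⟨r', hr'⟩, Fin.rev ⟨r, hr.trans hr'⟩⟩, ?_, ?_⟩
      · simpa using hr
      · simp [f, -Fin.val_rev]
  change Submodule.span ℂ _ = Submodule.span ℂ _
  congr 1
  ext x
  constructor
  · rintro ⟨T, rfl⟩
    exact ⟨_, T.injective.comp hf, hS T⟩
  · rintro ⟨a, ha, rfl⟩
    obtain ⟨T, hT⟩ := exists_tableau_extending hf ha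
    refine ⟨T, ?_⟩
    simp only
    rw [hS]
    congr 1
    ext1 l
    exact hT l

end SymChar

namespace SymChar

open Equiv Polynomial

/-! ### Character values of two-rowed shapes and of hooks -/

theorem chi_twoRowed {n : ℕ} (j : Fin (n / 2 + 1)) (q : n.Partition) :
    chi (twoRowed n j) q =
      ((1 - X) * (q.parts.map fun r => 1 + X ^ r : Multiset ℂ[X]).prod).coeff j := by
  obtain ⟨σ, hσ⟩ := exists_perm_parts q
  rw [chi_eq _ q σ hσ, ← hσ]
  have key : ∀ (V : Submodule ℂ (MvPolynomial (Fin n) ℂ)) (hV : ∀ x ∈ V, polyRep n σ x ∈ V),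
      V = diffSpan (j : ℕ) Set.univ → LinearMap.trace ℂ V ((polyRep n σ).restrict hV) =
      ((1 - X) * (σ.partition.parts.map fun r => 1 + X ^ r : Multiset ℂ[X]).prod).coeff j := by
    rintro _ hV rfl
    exact trace_diffSpan σ (by have := j.2; omega) hV
  exact key _ ((spechtModule (twoRowed n j)).apply_mem_toSubmodule σ) (spechtModule_twoRowed j)

/-- The values of the hook characters as coefficients of a generating polynomial. Its factors are
the `1 - (-X) ^ r`, written as `1 + (-1) ^ (r + 1) * X ^ r`. -/
theorem chi_hook {n : ℕ} (j : Fin (n + 1)) (q : (n + 1).Partition) (F : ℂ[X])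
    (hF : (q.parts.map fun r => 1 + C ((-1) ^ (r + 1)) * X ^ r : Multiset ℂ[X]).prod =
      (1 + X) * F) : chi (hook (n + 1) j) q = F.coeff (n - j) := by
  obtain ⟨σ, hσ⟩ := exists_perm_parts q
  rw [chi_eq _ q σ hσ]
  rw [← hσ] at hF
  have key : ∀ (V : Submodule ℂ (MvPolynomial (Fin (n + 1)) ℂ))
      (hV : ∀ x ∈ V, polyRep (n + 1) σ x ∈ V), V = vdmSpan (n + 1) (n - j + 1) →
      LinearMap.trace ℂ V ((polyRep (n + 1) σ).restrict hV) = F.coeff (n - j) := by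
    rintro _ hV rfl
    exact trace_vdmSpan σ F hF (n - j)
  refine key _ ((spechtModule (hook (n + 1) j)).apply_mem_toSubmodule σ) ?_
  rw [spechtModule_hook, Nat.sub_add_comm (Nat.le_of_lt_succ j.2)]

/-! ### The generating polynomials -/

lemma parts_padOnes {m : Multiset ℕ} {n : ℕ} (h : m.sum ≤ n) (hm : ∀ x ∈ m, x ≠ 0) :
    (padOnes m n h).parts = m + Multiset.replicate (n - m.sum) 1 := by
  refine Multiset.filter_eq_self.2 fun x hx => ?_
  rcases Multiset.mem_add.1 hx with hx | hx
  · exact hm x hx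
  · rw [Multiset.eq_of_mem_replicate hx]
    exact one_ne_zero

lemma natDegree_prod_one_add_X_pow_le (m : Multiset ℕ) :
    (m.map fun r => 1 + X ^ r : Multiset ℂ[X]).prod.natDegree ≤ m.sum := by
  induction m using Multiset.induction_on with
  | empty => simp
  | cons r m ih =>
    rw [Multiset.map_cons, Multiset.prod_cons, Multiset.sum_cons]
    refine natDegree_mul_le.trans (add_le_add ?_ ih)
    exact (natDegree_add_le _ _).trans (by simp)

lemma reflect_prod_one_add_X_pow (m : Multiset ℕ) :
    reflect m.sum (m.map fun r => 1 + X ^ r : Multiset ℂ[X]).prod =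
      (m.map fun r => 1 + X ^ r : Multiset ℂ[X]).prod := by
  induction m using Multiset.induction_on with
  | empty => simp
  | cons r m ih =>
    rw [Multiset.map_cons, Multiset.prod_cons, Multiset.sum_cons, reflect_mul _ _
      ((natDegree_add_le _ _).trans (by simp)) (natDegree_prod_one_add_X_pow_le m), ih,
      reflect_add, reflect_one, reflect_monomial, revAt_le le_rfl, Nat.sub_self, pow_zero, add_comm]

/-- The polynomial `(1 - X) * ∏ (1 + X ^ r)` is antipalindromic. -/
lemma coeff_one_sub_X_mul_prod_symm (m : Multiset ℕ) {i k : ℕ} (h : i + k = m.sum + 1) :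
    ((1 - X) * (m.map fun r => 1 + X ^ r : Multiset ℂ[X]).prod).coeff i =
      -((1 - X) * (m.map fun r => 1 + X ^ r : Multiset ℂ[X]).prod).coeff k := by
  have hr : reflect (1 + m.sum) ((1 - X) * (m.map fun r => 1 + X ^ r : Multiset ℂ[X]).prod) =
      -((1 - X) * (m.map fun r => 1 + X ^ r : Multiset ℂ[X]).prod) := by
    rw [reflect_mul _ _ ((natDegree_sub_le _ _).trans (by simp))
      (natDegree_prod_one_add_X_pow_le m), reflect_prod_one_add_X_pow, sub_eq_add_neg, reflect_add,
      reflect_neg, reflect_one, reflect_one_X]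
    ring
  rw [← coeff_neg, ← hr, coeff_reflect, revAt_le (by omega)]
  congr 1
  omega

/-- The sum of the squares of an antisymmetric sequence is twice that of its first half. -/
lemma sum_sq_of_antisymm {n : ℕ} {f : ℕ → ℂ} (hf : ∀ i k, i + k = n + 1 → f i = -f k) :
    ∑ k ∈ Finset.range (n + 2), f k ^ 2 = 2 * ∑ k ∈ Finset.range (n / 2 + 1), f k ^ 2 := by
  -- Two mirror blocks of `m + 1` terms, separated by `d` vanishing terms.
  have key : ∀ m d : ℕ, m + m + 1 + d = n + 1 → (∀ x < d, f (m + 1 + x) = 0) →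
      ∑ k ∈ Finset.range (m + 1 + d + (m + 1)), f k ^ 2 =
        2 * ∑ k ∈ Finset.range (m + 1), f k ^ 2 := by
    intro m d hm hd
    rw [Finset.sum_range_add, Finset.sum_range_add,
      Finset.sum_eq_zero (s := Finset.range d) fun x hx => by
        rw [hd x (Finset.mem_range.1 hx), zero_pow two_ne_zero],
      ← Finset.sum_range_reflect (fun k => f k ^ 2) (m + 1), add_zero, two_mul]
    congr 1
    refine Finset.sum_congr rfl fun x hx => ?_
    have := Finset.mem_range.1 hx
    rw [hf (m + 1 + d + x) (m + 1 - 1 - x) (by omega), neg_sq]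
  rcases Nat.even_or_odd' n with ⟨m, rfl | rfl⟩
  · rw [Nat.mul_div_cancel_left m two_pos, ← key m 0 (by omega) (by simp)]
    congr 2
    omega
  · have h0 : f (m + 1) = 0 := self_eq_neg.1 (hf _ _ (by omega))
    rw [show (2 * m + 1) / 2 = m by omega, ← key m 1 (by omega) (by simpa using h0)]
    congr 2
    omega

lemma one_sub_X_mul_prod_two_pow {t : ℕ} (ht : 1 ≤ t) :
    (1 + X) * ((1 - X) * ∏ i ∈ Finset.Ico 1 t, (1 + X ^ (2 ^ i))) = (1 - X ^ (2 ^ t) : ℂ[X]) := by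
  induction t, ht using Nat.le_induction with
  | base => simp; ring
  | succ t ht ih =>
    rw [Finset.prod_Ico_succ_top ht, ← mul_assoc (1 - X), ← mul_assoc, ih]
    ring

/-- For odd `a` the two generating polynomials differ by the factor `1 + X`. -/
lemma prod_withTopPower {a : Multiset ℕ} (ha : ∀ x ∈ a, Odd x) {t : ℕ} (ht : 1 ≤ t) (l : ℕ) :
    ((withTopPower a t + Multiset.replicate l 1).map
      fun r => 1 + C ((-1) ^ (r + 1)) * X ^ r : Multiset ℂ[X]).prod =
    (1 + X) * ((1 - X) * ((withPowers a t + Multiset.replicate l 1).map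
      fun r => 1 + X ^ r : Multiset ℂ[X]).prod) := by
  have h1 : (a.map fun r => 1 + C ((-1) ^ (r + 1)) * X ^ r : Multiset ℂ[X]) =
      a.map fun r => 1 + X ^ r := by
    refine Multiset.map_congr rfl fun r hr => ?_
    rw [(ha r hr).add_one.neg_one_pow]
    simp
  have h2 : (-1 : ℂ) ^ (2 ^ t + 1) = -1 :=
    (((even_two.pow_of_ne_zero (by omega)).add_one).neg_one_pow)
  have h3 : (((Finset.Ico 1 t).val.map (2 ^ ·)).map fun r => 1 + X ^ r : Multiset ℂ[X]).prod =
      ∏ i ∈ Finset.Ico 1 t, (1 + X ^ (2 ^ i)) := by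
    rw [Multiset.map_map]; rfl
  simp only [withTopPower, withPowers, Multiset.map_add, Multiset.prod_add, h1, h3,
    Multiset.map_singleton, Multiset.prod_singleton, h2, Multiset.map_replicate,
    Multiset.prod_replicate]
  have h4 := one_sub_X_mul_prod_two_pow ht
  have h5 : (1 + C (-1) * X ^ (2 ^ t) : ℂ[X]) = 1 - X ^ (2 ^ t) := by simp [sub_eq_add_neg]
  rw [h5, ← h4]
  norm_num
  ring

end SymChar

theorem mainTheorem1 (a : Multiset ℕ) (ha : ∀ x ∈ a, Odd x ∧ 3 ≤ x) (t : ℕ) (ht : 1 ≤ t)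
    (n : ℕ) (hn : (SymChar.withPowers a t).sum ≤ n) :
    SymChar.sumSqTwoRowed (SymChar.withPowers a t) n hn =
      1 / 2 * SymChar.sumSqHook (SymChar.withTopPower a t) (n + 2)
        (SymChar.sum_withTopPower_le ht hn) := by
  open SymChar Polynomial in
  have hpow : ∀ x ∈ withPowers a t, x ≠ 0 := by
    intro x hx
    rcases Multiset.mem_add.1 hx with hx | hx
    · have := (ha x hx).2
      omega
    · obtain ⟨i, -, rfl⟩ := Multiset.mem_map.1 hx
      positivity
  have htop : ∀ x ∈ withTopPower a t, x ≠ 0 := by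
    intro x hx
    rcases Multiset.mem_add.1 hx with hx | hx
    · have := (ha x hx).2
      omega
    · rw [Multiset.mem_singleton.1 hx]
      positivity
  have hl : n + 2 - (withTopPower a t).sum = n - (withPowers a t).sum := by
    rw [sum_withTopPower ht]
    omega
  have hparts := parts_padOnes hn hpow
  have hparts' := parts_padOnes (sum_withTopPower_le ht hn) htop
  rw [hl] at hparts'
  have hsum : (padOnes (withPowers a t) n hn).parts.sum = n := Nat.Partition.parts_sum _
  have hF := prod_withTopPower (fun x hx => (ha x hx).1) ht (n - (withPowers a t).sum)
  rw [← hparts, ← hparts'] at hF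
  set F : ℂ[X] := (1 - X) * ((padOnes (withPowers a t) n hn).parts.map
    fun r => 1 + X ^ r : Multiset ℂ[X]).prod with hFdef
  have hA : sumSqTwoRowed (withPowers a t) n hn =
      ∑ k ∈ Finset.range (n / 2 + 1), F.coeff k ^ 2 := by
    rw [sumSqTwoRowed, ← Fin.sum_univ_eq_sum_range fun k => F.coeff k ^ 2]
    exact Finset.sum_congr rfl fun j _ => by rw [chi_twoRowed]
  have hB : sumSqHook (withTopPower a t) (n + 2) (sum_withTopPower_le ht hn) =
      ∑ k ∈ Finset.range (n + 2), F.coeff k ^ 2 := by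
    rw [sumSqHook, ← Finset.sum_range_reflect,
      ← Fin.sum_univ_eq_sum_range fun k => F.coeff (n + 2 - 1 - k) ^ 2]
    exact Finset.sum_congr rfl fun j _ => by rw [chi_hook j _ F hF]; rfl
  rw [hA, hB, sum_sq_of_antisymm fun i k h => coeff_one_sub_X_mul_prod_symm _ (by rw [hsum, h])]
  ring
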